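/- Definitions. An ideal on $\omega$ is a nonempty family of subsets of $\omega$ closed under subsets and finite unions. It is $F_\sigma$ if it is an $F_\sigma$ subset of $\mathcal P(\omega)$, identified with the Cantor space $2^\omega$. For an ideal $I$ on $\omega$, let $P(I)$ be the poset of all trees $T\subseteq\omega^{<\omega}$ that have a trunk $t$ (a node $t\in T$ comparable with every node of $T$) such that for every $s\in T$ extending $t$ the set $\{n\in\omega: s^\smallfrown n\in T\}$ is not in $I$; the ordering is inclusion, so that smaller trees are stronger conditions. Laver forcing is the poset, also ordered by inclusion, of all trees $T\subseteq\omega^{<\omega}$ with a trunk $t$ such that every $s\in T$ extending $t$ has infinitely many immediate successors in $T$. For a poset $P$ let $RO(P)$ be its completion, the Boolean algebra of regular open subsets of $P$ (in the topology of downward closed sets). The poset $P$ is Y-proper if for every large enough regular cardinal $\theta$, every countable elementary submodel $M\prec H_\theta$ with $P\in M$ and every condition $p\in P\cap M$, there is $q\le p$ such that 1. $q$ is a master condition for $M$: for every dense set $D\subseteq P$ in $M$, the set $D\cap M$ is predense below $q$; and 2. for every $r\le q$ there is a (proper) filter $F\in M$ on $RO(P)$ such that $\{s\in RO(P)\cap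 M: s\ge r\}\subseteq F$. Theorem. Let $I$ be an ideal on $\omega$. If $I$ is the intersection of a family of $F_\sigma$ ideals on $\omega$, then $P(I)$ is Y-proper. In particular, Laver forcing is Y-proper. -/

import Mathlib

universe u

noncomputable section

namespace YProperness

/-! ### The structures `H_θ` and their countable elementary submodels -/

/-- The only symbol of the language of set theory: a binary relation symbol for membership. -/
inductive MemSymbol : ℕ → Type
  | mem : MemSymbol 2

/-- The first-order language of set theory (equality is built in). -/
def setLanguage : FirstOrder.Language.{0, 0} := ⟨fun _ => Empty, MemSymbol⟩

/-- `H_θ`, the collection of all sets whose transitive closure has size less than `θ`.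
The elements of the transitive closure of `x` are the sets joined to `x` by a finite,
nonempty chain of memberships. -/
def H (θ : Cardinal.{u}) : Set ZFSet.{u} :=
  {x | Cardinal.mk {z : ZFSet.{u} // Relation.TransGen (fun a b : ZFSet.{u} => a ∈ b) z x} <
    Cardinal.lift.{u + 1} θ}

/-- `H_θ` as a first-order structure, with the true membership relation. -/
instance memStructure (θ : Cardinal.{u}) : setLanguage.Structure (H θ) where
  funMap := fun f _ => Empty.elim f
  RelMap := fun {_} r => match r with
    | MemSymbol.mem => fun v => (v 0 : ZFSet.{u}) ∈ (v 1 : ZFSet.{u})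

/-- `M` is (the universe of) a countable elementary submodel of `H_θ`. -/
def IsCountableElementarySubmodel (θ : Cardinal.{u}) (M : Set ZFSet.{u}) : Prop :=
  M.Countable ∧ ∃ N : setLanguage.ElementarySubstructure (H θ),
    M = Subtype.val '' (N : Set (H θ))

/-! ### Posets that are sets, and their completions -/

/-- A partially ordered set inside the universe of sets: an underlying set together with a
set of ordered pairs which is a partial ordering of it. -/
structure SetPoset where
  /-- The set of conditions. -/
  carrier : ZFSet.{u}
  /-- The ordering, as a set of ordered pairs. -/
  rel : ZFSet.{u}
  rel_subset : rel ⊆ ZFSet.prod carrier carrier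
  refl : ∀ p ∈ carrier, ZFSet.pair p p ∈ rel
  antisymm : ∀ p q, ZFSet.pair p q ∈ rel → ZFSet.pair q p ∈ rel → p = q
  trans : ∀ p q r, ZFSet.pair p q ∈ rel → ZFSet.pair q r ∈ rel → ZFSet.pair p r ∈ rel

namespace SetPoset

variable (P : SetPoset.{u})

/-- The poset as a single set, the ordered pair of the underlying set and the ordering. -/
def toZFSet : ZFSet.{u} := ZFSet.pair P.carrier P.rel

/-- `q ≤ p`: the condition `q` is stronger than `p`. -/
def Le (q p : ZFSet.{u}) : Prop := ZFSet.pair q p ∈ P.rel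

/-- Two conditions are compatible if they have a common lower bound. -/
def Compatible (p q : ZFSet.{u}) : Prop := ∃ r ∈ P.carrier, P.Le r p ∧ P.Le r q

/-- `D` is a dense set of conditions. -/
def IsDense (D : ZFSet.{u}) : Prop :=
  D ⊆ P.carrier ∧ ∀ p ∈ P.carrier, ∃ d ∈ D, P.Le d p

/-- `b` is a regular open subset of `P`, that is, an element of the completion `RO(P)`:
a downward closed set of conditions containing every condition below which it is dense. -/
def IsRegularOpen (b : ZFSet.{u}) : Prop :=
  b ⊆ P.carrier ∧
  (∀ p ∈ b, ∀ q ∈ P.carrier, P.Le q p → q ∈ b) ∧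
  (∀ p ∈ P.carrier, (∀ q ∈ P.carrier, P.Le q p → ∃ r ∈ b, P.Le r q) → p ∈ b)

/-- The underlying set of the completion `RO(P)`, the complete Boolean algebra of regular open
subsets of `P`. It is ordered by inclusion, its zero is the empty set, its unit is the set of all
conditions, and its meet is intersection. -/
def RO : ZFSet.{u} := ZFSet.sep P.IsRegularOpen (ZFSet.powerset P.carrier)

/-- The canonical image in `RO(P)` of a condition `p`: all conditions below which the conditions
stronger than `p` are dense. -/
def embed (p : ZFSet.{u}) : ZFSet.{u} :=
  ZFSet.sep (fun x => ∀ y ∈ P.carrier, P.Le y x → P.Compatible y p) P.carrier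

/-- `F` is a (proper) filter on the Boolean algebra `RO(P)`. -/
def IsFilterRO (F : ZFSet.{u}) : Prop :=
  F ⊆ P.RO ∧ P.carrier ∈ F ∧ ∅ ∉ F ∧
  (∀ a ∈ F, ∀ b ∈ P.RO, a ⊆ b → b ∈ F) ∧
  (∀ a ∈ F, ∀ b ∈ F, a ∩ b ∈ F)

/-- `q` is a master condition for `M`: for every dense set `D ∈ M` of conditions, the set `D ∩ M`
is predense below `q`. -/
def IsMaster (M : Set ZFSet.{u}) (q : ZFSet.{u}) : Prop :=
  ∀ D ∈ M, P.IsDense D → ∀ r ∈ P.carrier, P.Le r q → ∃ d ∈ D, d ∈ M ∧ P.Compatible d r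

/-- `q` is a Y-master condition for `M`. -/
def IsYMaster (M : Set ZFSet.{u}) (q : ZFSet.{u}) : Prop :=
  P.IsMaster M q ∧
  ∀ r ∈ P.carrier, P.Le r q →
    ∃ F ∈ M, P.IsFilterRO F ∧ ∀ s ∈ P.RO, s ∈ M → P.embed r ⊆ s → s ∈ F

/-- `P` is Y-proper: for all large enough regular `θ`, every countable elementary submodel `M` of
`H_θ` containing `P` and every condition `p ∈ P ∩ M`, there is a Y-master condition `q ≤ p`
for `M`. -/
def YProper : Prop :=
  ∃ θ₀ : Cardinal.{u}, ∀ θ : Cardinal.{u}, θ₀ ≤ θ → θ.IsRegular →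
    ∀ M : Set ZFSet.{u}, IsCountableElementarySubmodel θ M → P.toZFSet ∈ M →
      ∀ p ∈ P.carrier, p ∈ M → ∃ q ∈ P.carrier, P.Le q p ∧ P.IsYMaster M q

end SetPoset

/-! ### Posets of trees of finite sequences of natural numbers, as sets -/

/-- A finite sequence of natural numbers as a set: a function from a von Neumann natural number
to the von Neumann natural numbers. -/
def seqCode (s : List ℕ) : ZFSet.{u} :=
  ZFSet.range fun i : Fin s.length =>
    ZFSet.pair (Ordinal.toZFSet ((i : ℕ) : Ordinal.{u})) (Ordinal.toZFSet ((s.get i : ℕ) : Ordinal.{u}))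

/-- A tree as a set of finite sequences. -/
def treeCode (T : Descriptive.tree ℕ) : ZFSet.{u} :=
  ZFSet.range fun s : {s : List ℕ // s ∈ T} => seqCode.{u} s.1

/-- The set of all (codes of) trees in the collection `C`. -/
def treeSet (C : Set (Descriptive.tree ℕ)) : ZFSet.{u} :=
  ZFSet.range fun T : C => treeCode.{u} T.1

/-- The poset of all trees in the collection `C`, ordered by inclusion. -/
def treePoset (C : Set (Descriptive.tree ℕ)) : SetPoset.{u} where
  carrier := treeSet C
  rel := ZFSet.pairSep (fun S T => S ⊆ T) (treeSet C) (treeSet C)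
  rel_subset := by
    intro z hz
    obtain ⟨a, ha, b, hb, h, -⟩ := ZFSet.mem_pairSep.1 hz
    exact ZFSet.mem_prod.2 ⟨a, ha, b, hb, h⟩
  refl := fun p hp => ZFSet.mem_pairSep.2 ⟨p, hp, p, hp, rfl, fun _ h => h⟩
  antisymm := by
    intro p q h h'
    obtain ⟨a, -, b, -, e, hab⟩ := ZFSet.mem_pairSep.1 h
    obtain ⟨c, -, d, -, e', hcd⟩ := ZFSet.mem_pairSep.1 h'
    obtain ⟨rfl, rfl⟩ := ZFSet.pair_inj.1 e
    obtain ⟨rfl, rfl⟩ := ZFSet.pair_inj.1 e'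
    exact ZFSet.ext fun z => ⟨fun hz => hab hz, fun hz => hcd hz⟩
  trans := by
    intro p q r h h'
    obtain ⟨a, ha, b, -, e, hab⟩ := ZFSet.mem_pairSep.1 h
    obtain ⟨c, -, d, hd, e', hcd⟩ := ZFSet.mem_pairSep.1 h'
    obtain ⟨rfl, rfl⟩ := ZFSet.pair_inj.1 e
    obtain ⟨rfl, rfl⟩ := ZFSet.pair_inj.1 e'
    exact ZFSet.mem_pairSep.2 ⟨p, ha, r, hd, rfl, fun _ hz => hcd (hab hz)⟩

/-- `t` is a trunk of `T` above which every splitting set satisfies `Large`: `t` is a node of `T`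
comparable with all nodes of `T`, and for every node `s ∈ T` extending `t`, the set
`{n : s⌢n ∈ T}` satisfies `Large`. -/
def IsTrunkWith (Large : Set ℕ → Prop) (T : Descriptive.tree ℕ) (t : List ℕ) : Prop :=
  t ∈ T ∧ (∀ s ∈ T, s <+: t ∨ t <+: s) ∧
    ∀ s ∈ T, t <+: s → Large {n : ℕ | s ++ [n] ∈ T}

/-- The poset `P(I)` of trees with a trunk above which all splitting sets are `I`-positive. -/
def idealForcing (I : Order.Ideal (Set ℕ)) : SetPoset.{u} :=
  treePoset {T | ∃ t, IsTrunkWith (fun a => a ∉ I) T t}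

/-- Laver forcing: trees with a trunk above which every node has infinitely many immediate
successors. -/
def laverForcing : SetPoset.{u} :=
  treePoset {T | ∃ t, IsTrunkWith Set.Infinite T t}

/-! ### `F_σ` ideals -/

/-- An ideal on the natural numbers is `F_σ` if, under the identification of subsets of `ℕ` with
their characteristic functions, it is a countable union of closed subsets of the Cantor space. -/
def IsFSigmaIdeal (J : Order.Ideal (Set ℕ)) : Prop :=
  ∃ K : ℕ → Set (ℕ → Bool), (∀ k, IsClosed (K k)) ∧
    {x : ℕ → Bool | {n : ℕ | x n = true} ∈ J} = ⋃ k, K k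

/-- `I` is the intersection of a family of `F_σ` ideals. -/
def IsIntersectionOfFSigmaIdeals (I : Order.Ideal (Set ℕ)) : Prop :=
  ∃ 𝒥 : Set (Order.Ideal (Set ℕ)), (∀ J ∈ 𝒥, IsFSigmaIdeal J) ∧
    ∀ a : Set ℕ, a ∈ I ↔ ∀ J ∈ 𝒥, a ∈ J

end YProperness

end

open FirstOrder

namespace YProperness

/-! The Y-master condition comes from a fusion, and the filter required for a stronger condition `r`
is an ultrafilter fixed in advance at some node of the fusion.

Let `S` be a condition in the submodel `M` with trunk `x`, such that the successors `n` of `x` with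
`{n} ∈ I` form a set outside `I`, hence outside some `F_σ` ideal `J ⊇ I` of the family. For a
regular open `b` let `c(b)` be the set of those `n` for which `b` contains a condition below `S`
with trunk `x⌢n`. By `pure_decision`, any condition can be shrunk, keeping its trunk, into `b` or
into the complement of `b`; so `c(a)` is covered by `c(a ∩ b)` and `c(a ∩ ¬b)`, and Zorn's lemma
gives an ultrafilter `F` on `RO(P(I))` with `c(b) ∉ J` for all `b ∈ F`. Since `J` is `F_σ`, a
decreasing sequence of `J`-positive sets has a `J`-positive pseudo-intersection. Hence for each
countable `B ⊆ F` a single positive set of successors is almost contained in every `c(b)`, `b ∈ B`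
(`exists_ultra_captures`). By elementarity such an `F` exists in `M`, and it may be used with the
external set `B = F ∩ M` (`exists_ultra_mem`). This gives trees `G n ∈ M` with trunks `x⌢n` such
that each positive set of these successors contains, for each `b ∈ F ∩ M`, some `n` with `G n ∈ b`
(`exists_stepUltra`).

Fusing these choices while entering the dense sets of `M` gives `q`. Let `r ≤ q`, and let `F` belong
to a suitable node `z` of `r`. If `b ∈ M` contains `r` but `b ∉ F`, then some `b' ∈ F ∩ M` is
disjoint from `b`; some successor `z⌢n` in `r` carries a tree in `b'`, and the part of `r` through
`z⌢n` then lies in both `b` and `b'`, which is absurd.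

Singletons need not belong to `I`. If `r` has no node, above its trunk, whose successors are all
negligible, it contains a one-branch condition, which is minimal. When some condition below `p` is
minimal, one in `M` is itself Y-master, witnessed by a principal ultrafilter. Laver forcing is the
case of the `F_σ` ideal of finite sets. -/

theorem H_transitive {θ : Cardinal.{u}} {x y : ZFSet.{u}} (hx : x ∈ H θ) (hy : y ∈ x) :
    y ∈ H θ := by
  refine lt_of_le_of_lt (Cardinal.mk_le_of_injective
    (f := fun z => ⟨z.1, z.2.tail hy⟩) ?_) hx
  intro a b h
  simpa [Subtype.ext_iff] using h

/-! ### Definability over `H θ` and elementarity. -/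

section Definability

variable {θ : Cardinal.{u}} (N : setLanguage.ElementarySubstructure (H θ))

/-- Predicates of countably many variables which are defined over `H θ` by a first-order formula
with parameters in `N`. -/
def Dfn (φ : (ℕ → H θ) → Prop) : Prop :=
  ∃ ψ : setLanguage.Formula (ℕ ⊕ N), ∀ v : ℕ → H θ,
    ψ.Realize (Sum.elim v (fun c : N => (c : H θ))) ↔ φ v

/-- Terms: variables, or parameters in `N`. -/
def Tm (f : (ℕ → H θ) → ZFSet.{u}) : Prop :=
  ∃ i : ℕ ⊕ N, ∀ v : ℕ → H θ, f v = (Sum.elim v (fun c : N => (c : H θ)) i : H θ)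

variable {N}

theorem Tm.var (i : ℕ) : Tm N (fun v => (v i : ZFSet.{u})) := ⟨Sum.inl i, fun _ => rfl⟩

theorem Tm.par {c : ZFSet.{u}} (hc : c ∈ Subtype.val '' (N : Set (H θ))) :
    Tm N (fun _ => c) := by
  obtain ⟨d, hd, rfl⟩ := hc
  exact ⟨Sum.inr ⟨d, hd⟩, fun _ => rfl⟩

theorem Tm.tail {f : (ℕ → H θ) → ZFSet.{u}} (hf : Tm N f) :
    Tm N (fun w => f (fun i => w (i + 1))) := by
  obtain ⟨i, hi⟩ := hf
  refine ⟨i.map (· + 1) id, fun v => ?_⟩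
  refine (hi _).trans ?_
  cases i <;> rfl

theorem Tm.mem_H {f : (ℕ → H θ) → ZFSet.{u}} (hf : Tm N f) (v : ℕ → H θ) : f v ∈ H θ := by
  obtain ⟨i, hi⟩ := hf
  rw [hi]
  exact Subtype.property _

namespace Dfn

variable {φ φ' : (ℕ → H θ) → Prop} {f g k : (ℕ → H θ) → ZFSet.{u}}

theorem congr (h : Dfn N φ) (e : ∀ v, φ v ↔ φ' v) : Dfn N φ' := by
  obtain ⟨ψ, hψ⟩ := h
  exact ⟨ψ, fun v => (hψ v).trans (e v)⟩

theorem eq (hf : Tm N f) (hg : Tm N g) : Dfn N (fun v => f v = g v) := by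
  obtain ⟨i, hi⟩ := hf
  obtain ⟨j, hj⟩ := hg
  refine ⟨(Language.Term.var i).equal (Language.Term.var j), fun v => ?_⟩
  beta_reduce
  rw [Language.Formula.realize_equal, hi, hj]
  exact Subtype.ext_iff

theorem mem (hf : Tm N f) (hg : Tm N g) : Dfn N (fun v => f v ∈ g v) := by
  obtain ⟨i, hi⟩ := hf
  obtain ⟨j, hj⟩ := hg
  refine ⟨Language.Relations.formula₂ (L := setLanguage) MemSymbol.mem
    (Language.Term.var i) (Language.Term.var j), fun v => ?_⟩
  refine (Language.Formula.realize_rel₂ (L := setLanguage)).trans ?_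
  beta_reduce
  rw [hi, hj]
  rfl

theorem not (h : Dfn N φ) : Dfn N (fun v => ¬ φ v) := by
  obtain ⟨ψ, hψ⟩ := h
  exact ⟨ψ.not, fun v => by rw [Language.Formula.realize_not, hψ]⟩

theorem imp (h : Dfn N φ) (h' : Dfn N φ') : Dfn N (fun v => φ v → φ' v) := by
  obtain ⟨ψ, hψ⟩ := h
  obtain ⟨ψ', hψ'⟩ := h'
  exact ⟨ψ.imp ψ', fun v => by rw [Language.Formula.realize_imp, hψ, hψ']⟩

theorem and (h : Dfn N φ) (h' : Dfn N φ') : Dfn N (fun v => φ v ∧ φ' v) :=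
  (h.imp h'.not).not.congr fun v => by tauto

theorem or (h : Dfn N φ) (h' : Dfn N φ') : Dfn N (fun v => φ v ∨ φ' v) :=
  (h.not.imp h').congr fun v => by tauto

theorem iff (h : Dfn N φ) (h' : Dfn N φ') : Dfn N (fun v => φ v ↔ φ' v) :=
  ((h.imp h').and (h'.imp h)).congr fun v => by tauto

/-- Variables are handled in de Bruijn style: variable `0` is the one being bound and the outer
variables are shifted by one, which is what `Tm.tail` does to terms. -/
theorem ex {φ : (ℕ → H θ) → H θ → Prop} (h : Dfn N (fun w => φ (fun i => w (i + 1)) (w 0))) :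
    Dfn N (fun v => ∃ x, φ v x) := by
  obtain ⟨ψ, hψ⟩ := h
  let r : ℕ ⊕ N → (ℕ ⊕ N) ⊕ Unit := Sum.elim
    (fun n => Nat.casesOn n (Sum.inr ()) (fun m => Sum.inl (Sum.inl m)))
    (fun c => Sum.inl (Sum.inr c))
  refine ⟨(ψ.relabel r).iExs Unit, fun v => ?_⟩
  rw [Language.Formula.realize_iExs]
  have key : ∀ i : Unit → H θ,
      (ψ.relabel r).Realize (Sum.elim (Sum.elim v (fun c : N => (c : H θ))) i) ↔ φ v (i ()) := by
    intro i
    rw [Language.Formula.realize_relabel]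
    refine Iff.trans (Eq.to_iff (congrArg _ ?_))
      (hψ (fun n => Nat.casesOn n (i ()) (fun m => v m)))
    funext a
    rcases a with (_ | n) | c <;> rfl
  constructor
  · rintro ⟨i, hi⟩
    exact ⟨i (), (key i).1 hi⟩
  · rintro ⟨x, hx⟩
    exact ⟨fun _ => x, (key _).2 hx⟩

theorem all {φ : (ℕ → H θ) → H θ → Prop} (h : Dfn N (fun w => φ (fun i => w (i + 1)) (w 0))) :
    Dfn N (fun v => ∀ x, φ v x) :=
  (Dfn.ex (φ := fun v x => ¬ φ v x) h.not).not.congr fun v => by push Not; rfl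

/-- Transitivity of `H θ` makes bounded quantifiers over all sets agree with those over `H θ`. -/
theorem bex {φ : (ℕ → H θ) → ZFSet.{u} → Prop} (hf : Tm N f)
    (h : Dfn N (fun w => φ (fun i => w (i + 1)) (w 0 : ZFSet.{u}))) :
    Dfn N (fun v => ∃ x ∈ f v, φ v x) := by
  refine (Dfn.ex (φ := fun v x => (x : ZFSet.{u}) ∈ f v ∧ φ v x)
    (((Dfn.mem (Tm.var 0) hf.tail)).and h)).congr fun v => ?_
  constructor
  · rintro ⟨x, hx, hx'⟩
    exact ⟨x, hx, hx'⟩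
  · rintro ⟨x, hx, hx'⟩
    exact ⟨⟨x, H_transitive (hf.mem_H v) hx⟩, hx, hx'⟩

theorem ball {φ : (ℕ → H θ) → ZFSet.{u} → Prop} (hf : Tm N f)
    (h : Dfn N (fun w => φ (fun i => w (i + 1)) (w 0 : ZFSet.{u}))) :
    Dfn N (fun v => ∀ x ∈ f v, φ v x) :=
  (Dfn.bex (φ := fun v x => ¬ φ v x) hf h.not).not.congr fun v => by push Not; rfl

theorem subset (hf : Tm N f) (hg : Tm N g) : Dfn N (fun v => f v ⊆ g v) :=
  (Dfn.ball (φ := fun v x => x ∈ g v) hf (Dfn.mem (Tm.var 0) hg.tail)).congr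
    fun _ => ⟨fun h _ hx => h _ hx, fun h _ hx => h hx⟩

theorem eq_insert (hf : Tm N f) (hg : Tm N g) (hk : Tm N k) :
    Dfn N (fun v => f v = insert (g v) (k v)) := by
  refine ((Dfn.mem hg hf).and ((Dfn.subset hk hf).and
    (Dfn.ball (φ := fun v x => x = g v ∨ x ∈ k v) hf
      ((Dfn.eq (Tm.var 0) hg.tail).or (Dfn.mem (Tm.var 0) hk.tail))))).congr fun v => ?_
  constructor
  · rintro ⟨h1, h2, h3⟩
    ext z
    rw [ZFSet.mem_insert_iff]
    exact ⟨h3 z, fun h => h.elim (fun h => h ▸ h1) (fun h => h2 h)⟩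
  · intro h
    rw [h]
    exact ⟨ZFSet.mem_insert _ _, fun _ hx => ZFSet.mem_insert_of_mem _ hx,
      fun z hz => ZFSet.mem_insert_iff.1 hz⟩

theorem eq_singleton (hf : Tm N f) (hg : Tm N g) : Dfn N (fun v => f v = {g v}) := by
  refine ((Dfn.mem hg hf).and
    (Dfn.ball (φ := fun v x => x = g v) hf (Dfn.eq (Tm.var 0) hg.tail))).congr fun v => ?_
  constructor
  · rintro ⟨h1, h2⟩
    ext z
    rw [ZFSet.mem_singleton]
    exact ⟨h2 z, fun h => h ▸ h1⟩
  · intro h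
    rw [h]
    exact ⟨ZFSet.mem_singleton.2 rfl, fun z hz => ZFSet.mem_singleton.1 hz⟩

theorem eq_unorderedPair (hf : Tm N f) (hg : Tm N g) (hk : Tm N k) :
    Dfn N (fun v => f v = {g v, k v}) := by
  refine ((Dfn.mem hg hf).and ((Dfn.mem hk hf).and
    (Dfn.ball (φ := fun v x => x = g v ∨ x = k v) hf
      ((Dfn.eq (Tm.var 0) hg.tail).or (Dfn.eq (Tm.var 0) hk.tail))))).congr fun v => ?_
  constructor
  · rintro ⟨h1, h2, h3⟩
    ext z
    rw [ZFSet.mem_pair]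
    exact ⟨h3 z, fun h => h.elim (fun h => h ▸ h1) (fun h => h ▸ h2)⟩
  · intro h
    rw [h]
    exact ⟨ZFSet.mem_pair.2 (Or.inl rfl), ZFSet.mem_pair.2 (Or.inr rfl),
      fun z hz => ZFSet.mem_pair.1 hz⟩

theorem eq_pair (hf : Tm N f) (hg : Tm N g) (hk : Tm N k) :
    Dfn N (fun v => f v = ZFSet.pair (g v) (k v)) := by
  refine ((Dfn.bex (φ := fun v x => x = {g v}) hf (Dfn.eq_singleton (Tm.var 0) hg.tail)).and
    ((Dfn.bex (φ := fun v x => x = {g v, k v}) hf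
      (Dfn.eq_unorderedPair (Tm.var 0) hg.tail hk.tail)).and
    (Dfn.ball (φ := fun v x => x = {g v} ∨ x = {g v, k v}) hf
      ((Dfn.eq_singleton (Tm.var 0) hg.tail).or
        (Dfn.eq_unorderedPair (Tm.var 0) hg.tail hk.tail))))).congr fun v => ?_
  constructor
  · rintro ⟨⟨_, h1, rfl⟩, ⟨_, h2, rfl⟩, h3⟩
    ext z
    rw [ZFSet.pair, ZFSet.mem_pair]
    exact ⟨h3 z, fun h => h.elim (fun h => h ▸ h1) (fun h => h ▸ h2)⟩
  · intro h
    rw [h, ZFSet.pair]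
    exact ⟨⟨_, ZFSet.mem_pair.2 (Or.inl rfl), rfl⟩, ⟨_, ZFSet.mem_pair.2 (Or.inr rfl), rfl⟩,
      fun z hz => ZFSet.mem_pair.1 hz⟩

theorem pair_mem (hf : Tm N f) (hg : Tm N g) (hk : Tm N k) :
    Dfn N (fun v => ZFSet.pair (f v) (g v) ∈ k v) :=
  (Dfn.bex (φ := fun v x => x = ZFSet.pair (f v) (g v)) hk
    (Dfn.eq_pair (Tm.var 0) hf.tail hg.tail)).congr
    fun _ => ⟨fun ⟨_, h, e⟩ => e ▸ h, fun h => ⟨_, h, rfl⟩⟩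

end Dfn

/-- The Tarski–Vaught property of elementary submodels. -/
theorem exists_mem_of_dfn {φ : ZFSet.{u} → Prop} (h : Dfn N (fun w => φ (w 0 : ZFSet.{u})))
    (hex : ∃ x ∈ H θ, φ x) : ∃ x ∈ Subtype.val '' (N : Set (H θ)), φ x := by
  obtain ⟨ψ, hψ⟩ := h
  -- The truth value depends on variable `0` only, so all variables can be merged into one before
  -- quantifying.
  let r : ℕ ⊕ N → N ⊕ Unit := Sum.elim (fun _ => Sum.inr ()) Sum.inl
  have key : ∀ x : H θ, (ψ.relabel r).Realize
      (Sum.elim (fun c : N => (c : H θ)) (fun _ : Unit => x)) ↔ φ x := by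
    intro x
    rw [Language.Formula.realize_relabel]
    refine Iff.trans (Eq.to_iff (congrArg _ ?_)) (hψ (fun _ => x))
    funext a
    rcases a with n | c <;> rfl
  have h1 : ((ψ.relabel r).iExs Unit).Realize (fun c : N => (c : H θ)) := by
    rw [Language.Formula.realize_iExs]
    obtain ⟨x, hx, hφ⟩ := hex
    exact ⟨fun _ => ⟨x, hx⟩, (key ⟨x, hx⟩).2 hφ⟩
  have h2 : ((ψ.relabel r).iExs Unit).Realize (id : N → N) :=
    (N.subtype.map_formula _ id).1 h1
  rw [Language.Formula.realize_iExs] at h2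
  obtain ⟨i, hi⟩ := h2
  refine ⟨(i () : H θ), ⟨_, (i ()).2, rfl⟩, (key _).1 ?_⟩
  have h3 := (N.subtype.map_formula _ _).2 hi
  refine (Eq.to_iff (congrArg _ ?_)).1 h3
  funext a
  rcases a with c | c <;> rfl

end Definability

end YProperness

namespace YProperness

/-! ### Combinatorics of trees with positive splitting. -/

section Trees

open Descriptive

variable {I : Order.Ideal (Set ℕ)}

/-- `t` is a trunk of `T` above which `T` has `I`-positive splitting. -/
abbrev Trunk (I : Order.Ideal (Set ℕ)) (T : tree ℕ) (t : List ℕ) : Prop :=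
  IsTrunkWith (fun a => a ∉ I) T t

/-- `T` is a condition of `P(I)`. -/
abbrev Cond (I : Order.Ideal (Set ℕ)) (T : tree ℕ) : Prop := ∃ t, Trunk I T t

theorem positive_mono {a b : Set ℕ} (h : a ⊆ b) (ha : a ∉ I) : b ∉ I :=
  fun hb => ha (I.lower h hb)

theorem positive_nonempty {a : Set ℕ} (ha : a ∉ I) : a.Nonempty := by
  by_contra h
  rw [Set.not_nonempty_iff_eq_empty] at h
  exact ha (h ▸ I.bot_mem)

theorem union_mem_ideal {a b : Set ℕ} (ha : a ∈ I) (hb : b ∈ I) : a ∪ b ∈ I :=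
  Order.Ideal.sup_mem ha hb

theorem finite_mem_ideal {a : Set ℕ} (ha : a.Finite) (h : ∀ n ∈ a, {n} ∈ I) : a ∈ I := by
  induction a, ha using Set.Finite.induction_on with
  | empty => exact I.bot_mem
  | @insert n s _ _ ih =>
    exact union_mem_ideal (h n (Set.mem_insert _ _))
      (ih fun m hm => h m (Set.mem_insert_of_mem _ hm))

theorem concat_prefix_comparable {x s : List ℕ} {a : ℕ} (h : x ++ [a] <+: s ∨ s <+: x ++ [a]) :
    x <+: s ∨ s <+: x := by
  rcases h with h | h
  · exact Or.inl ((List.prefix_append _ _).trans h)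
  · rcases List.prefix_concat_iff.1 h with rfl | h
    · exact Or.inl (List.prefix_append _ _)
    · exact Or.inr h

theorem eq_of_concat_prefix {z s : List ℕ} {m n : ℕ} (h : z ++ [m] <+: s) (h' : z ++ [n] <+: s) :
    m = n := by
  have := List.prefix_of_prefix_length_le h h' (by simp)
  have := this.eq_of_length (by simp)
  simpa using this

theorem exists_concat_prefix {z s : List ℕ} (h : z <+: s) (h' : z.length < s.length) :
    ∃ n, z ++ [n] <+: s := by
  obtain ⟨l, rfl⟩ := h
  cases l with
  | nil => simp at h'
  | cons n l => exact ⟨n, l, by simp⟩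

/-- The nodes of `T` which are comparable with `s`. -/
def restrict (T : tree ℕ) (s : List ℕ) : tree ℕ :=
  ⟨{u | u ∈ T ∧ (u <+: s ∨ s <+: u)},
    fun _ _ h => ⟨Tree.mem_of_append h.1, concat_prefix_comparable h.2⟩⟩

theorem restrict_le (T : tree ℕ) (s : List ℕ) : restrict T s ≤ T := fun _ h => h.1

theorem restrict_mono {T T' : tree ℕ} (h : T ≤ T') (s : List ℕ) : restrict T s ≤ restrict T' s :=
  fun _ hu => ⟨h hu.1, hu.2⟩

theorem trunk_restrict {T : tree ℕ} {t s : List ℕ} (h : Trunk I T t) (hs : s ∈ T)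
    (hts : t <+: s) : Trunk I (restrict T s) s := by
  refine ⟨⟨hs, Or.inl List.prefix_rfl⟩, fun u hu => hu.2, fun u hu hsu => ?_⟩
  exact positive_mono (fun n hn => ⟨hn, Or.inr (hsu.trans (List.prefix_append _ _))⟩)
    (h.2.2 u hu.1 (hts.trans hsu))

theorem Trunk.exists_long {T : tree ℕ} {t : List ℕ} (h : Trunk I T t) (k : ℕ) :
    ∃ s ∈ T, t <+: s ∧ k ≤ s.length := by
  induction k with
  | zero => exact ⟨t, h.1, List.prefix_rfl, Nat.zero_le _⟩
  | succ k ih =>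
    obtain ⟨s, hs, hts, hk⟩ := ih
    obtain ⟨n, hn⟩ := positive_nonempty (h.2.2 s hs hts)
    exact ⟨s ++ [n], hn, hts.trans (List.prefix_append _ _), by simpa using hk⟩

/-- If the given trunk is shorter than `y`, then `y` lies below a long node of `T`, and `y` itself
serves as a trunk. -/
theorem Trunk.exists_extension {T : tree ℕ} {t y : List ℕ} (h : Trunk I T t)
    (hy : ∀ s ∈ T, s <+: y ∨ y <+: s) : ∃ t', Trunk I T t' ∧ y <+: t' := by
  rcases hy t h.1 with hty | hyt
  · refine ⟨y, ⟨?_, hy, fun s hs hys => h.2.2 s hs (hty.trans hys)⟩, List.prefix_rfl⟩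
    obtain ⟨s, hs, -, hlen⟩ := h.exists_long y.length
    rcases hy s hs with hsy | hys
    · exact hsy.eq_of_length_le hlen ▸ hs
    · exact Tree.mem_of_prefix hys hs
  · exact ⟨t, h, hyt⟩

/-- The union of the trees `G n` for `n ∈ c`. -/
def amalgam (c : Set ℕ) (G : ℕ → tree ℕ) : tree ℕ :=
  ⟨{s | ∃ n ∈ c, s ∈ G n}, fun _ _ ⟨n, hn, h⟩ => ⟨n, hn, Tree.mem_of_append h⟩⟩

section Amalgam

variable {c : Set ℕ} {G : ℕ → tree ℕ} {z : List ℕ}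

theorem mem_of_concat_mem_amalgam (hG : ∀ n ∈ c, Trunk I (G n) (z ++ [n])) {n : ℕ}
    {s : List ℕ} (hs : s ∈ amalgam c G) (hn : z ++ [n] <+: s) : n ∈ c ∧ s ∈ G n := by
  obtain ⟨m, hm, hsm⟩ := hs
  have : n = m := by
    rcases (hG m hm).2.1 s hsm with h | h
    · have h1 := hn.trans h
      exact eq_of_concat_prefix h1 List.prefix_rfl
    · exact eq_of_concat_prefix hn h
  subst this
  exact ⟨hm, hsm⟩

theorem trunk_amalgam (hc : c ∉ I) (hG : ∀ n ∈ c, Trunk I (G n) (z ++ [n])) :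
    Trunk I (amalgam c G) z := by
  refine ⟨?_, ?_, ?_⟩
  · obtain ⟨n, hn⟩ := positive_nonempty hc
    exact ⟨n, hn, Tree.mem_of_append (hG n hn).1⟩
  · rintro s ⟨n, hn, hs⟩
    exact (concat_prefix_comparable ((hG n hn).2.1 s hs).symm).symm
  · rintro s ⟨n, hn, hs⟩ hzs
    rcases hzs.length_le.lt_or_eq with hlt | heq
    · obtain ⟨m, hm⟩ := exists_concat_prefix hzs hlt
      obtain ⟨hmc, hsm⟩ := mem_of_concat_mem_amalgam hG ⟨n, hn, hs⟩ hm
      exact positive_mono (fun k hk => ⟨m, hmc, hk⟩) ((hG m hmc).2.2 s hsm hm)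
    · obtain rfl := hzs.eq_of_length heq
      exact positive_mono (fun k hk => ⟨k, hk, (hG k hk).1⟩) hc

/-- The trees `G n` are predense below their amalgam, so a regular open set containing all of them
contains the amalgam. -/
theorem exists_le_of_le_amalgam (hG : ∀ n ∈ c, Trunk I (G n) (z ++ [n]))
    (hc : c ∉ I) {R : tree ℕ} (hR : Cond I R) (hle : R ≤ amalgam c G) :
    ∃ n ∈ c, ∃ R' ≤ R, Cond I R' ∧ R' ≤ G n := by
  obtain ⟨t, ht⟩ := hR
  obtain ⟨t', ht', hzt'⟩ := ht.exists_extension (y := z)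
    fun s hs => (trunk_amalgam hc hG).2.1 s (hle hs)
  obtain ⟨s, hs, hts, hlen⟩ := ht'.exists_long (z.length + 1)
  obtain ⟨n, hn⟩ := exists_concat_prefix (hzt'.trans hts) hlen
  obtain ⟨hnc, hsn⟩ := mem_of_concat_mem_amalgam hG (hle hs) hn
  refine ⟨n, hnc, restrict R s, restrict_le R s, ⟨s, trunk_restrict ht' hs hts⟩, ?_⟩
  rintro u ⟨hu, hus | hsu⟩
  · exact Tree.mem_of_prefix hus hsn
  · exact (mem_of_concat_mem_amalgam hG (hle hu) (hn.trans hsu)).2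

end Amalgam

theorem Trunk.exists_prune {R : tree ℕ} {z : List ℕ} (h : Trunk I R z) {c : Set ℕ} (hc : c ∉ I)
    (hcR : ∀ n ∈ c, z ++ [n] ∈ R) :
    ∃ R' ≤ R, Trunk I R' z ∧ ∀ n, z ++ [n] ∈ R' → n ∈ c := by
  have hG : ∀ n ∈ c, Trunk I (restrict R (z ++ [n])) (z ++ [n]) := fun n hn =>
    trunk_restrict h (hcR n hn) (List.prefix_append _ _)
  refine ⟨amalgam c fun n => restrict R (z ++ [n]), ?_, trunk_amalgam hc hG, fun n hn =>
    (mem_of_concat_mem_amalgam hG hn List.prefix_rfl).1⟩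
  rintro s ⟨n, -, hs⟩
  exact hs.1

/-- Pure decision: every condition can be shrunk, without changing the trunk, into a given regular
open set of conditions or into its complement. -/
theorem pure_decision {B : Set (tree ℕ)}
    (hdown : ∀ G ∈ B, ∀ G' ≤ G, Cond I G' → G' ∈ B)
    (hreg : ∀ G, Cond I G → (∀ G' ≤ G, Cond I G' → ∃ G'' ≤ G', G'' ∈ B) → G ∈ B)
    (hcond : ∀ G ∈ B, Cond I G) {G : tree ℕ} {y : List ℕ} (hG : Trunk I G y) :
    ∃ G' ≤ G, Trunk I G' y ∧ (G' ∈ B ∨ ∀ G'' ≤ G', G'' ∉ B) := by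
  let good : List ℕ → Prop := fun z => ∃ G' ≤ G, Trunk I G' z ∧ G' ∈ B
  by_cases hy : good y
  · obtain ⟨G', h1, h2, h3⟩ := hy
    exact ⟨G', h1, h2, Or.inl h3⟩
  -- If positively many successors of `z` were good, amalgamating their witnesses would make `z`
  -- good.
  have hstep : ∀ z ∈ G, y <+: z → ¬ good z → {n | z ++ [n] ∈ G ∧ ¬ good (z ++ [n])} ∉ I := by
    intro z hz hyz hgz hbad
    have hc : {n | good (z ++ [n])} ∉ I := by
      intro hc
      refine hG.2.2 z hz hyz (I.lower ?_ (union_mem_ideal hbad hc))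
      intro n hn
      by_cases h : good (z ++ [n])
      · exact Or.inr h
      · exact Or.inl ⟨hn, h⟩
    choose! g hg1 hg2 hg3 using fun n (hn : n ∈ {n | good (z ++ [n])}) => hn
    refine hgz ⟨amalgam {n | good (z ++ [n])} g, ?_, trunk_amalgam hc hg2, ?_⟩
    · rintro s ⟨n, hn, hs⟩
      exact hg1 n hn hs
    · refine hreg _ ⟨z, trunk_amalgam hc hg2⟩ fun R hR hRc => ?_
      obtain ⟨n, hn, R', hR', hc', hle⟩ := exists_le_of_le_amalgam hg2 hc hRc hR
      exact ⟨R', hR', hdown _ (hg3 n hn) _ hle hc'⟩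
  -- Keep the nodes that are reached from `y` without passing a good node. A member of `B` below
  -- this tree would make its own trunk good.
  let G' : tree ℕ := ⟨{s | s ∈ G ∧ (s <+: y ∨ y <+: s) ∧ ∀ z, y <+: z → z <+: s → ¬ good z},
    fun x a h => ⟨Tree.mem_of_append h.1, concat_prefix_comparable h.2.1,
      fun z hz hzx => h.2.2 z hz (hzx.trans (List.prefix_append _ _))⟩⟩
  have hG' : Trunk I G' y := by
    refine ⟨⟨hG.1, Or.inl List.prefix_rfl, fun z hz hzy => ?_⟩, fun s hs => hs.2.1, ?_⟩
    · rwa [hzy.eq_of_length_le hz.length_le]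
    · intro s hs hys
      refine positive_mono ?_ (hstep s hs.1 hys (hs.2.2 s hys List.prefix_rfl))
      intro n hn
      refine ⟨hn.1, Or.inr (hys.trans (List.prefix_append _ _)), fun z hyz hz => ?_⟩
      rcases List.prefix_concat_iff.1 hz with rfl | hz
      · exact hn.2
      · exact hs.2.2 z hyz hz
  refine ⟨G', fun s hs => hs.1, hG', Or.inr fun G'' hle hB => ?_⟩
  obtain ⟨t, ht⟩ := hcond G'' hB
  obtain ⟨t', ht', hyt'⟩ := ht.exists_extension fun s hs => hG'.2.1 s (hle hs)
  exact (hle ht'.1).2.2 t' hyt' List.prefix_rfl ⟨G'', fun s hs => (hle hs).1, ht', hB⟩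

/-- Conditions that consist of a single branch are minimal. -/
theorem le_of_comparable {T U : tree ℕ} (hU : ∀ s ∈ U, ∀ u ∈ U, s <+: u ∨ u <+: s)
    (hT : Cond I T) (hle : T ≤ U) : U ≤ T := by
  intro u hu
  obtain ⟨t, ht⟩ := hT
  obtain ⟨s, hs, -, hlen⟩ := ht.exists_long u.length
  rcases hU u hu s (hle hs) with h | h
  · exact Tree.mem_of_prefix h hs
  · exact h.eq_of_length_le hlen ▸ hs

/-- A condition either has a node all of whose immediate successors are negligible, or contains a
condition which is a single branch. -/
theorem Trunk.exists_small_or_branch {r : tree ℕ} {x : List ℕ} (h : Trunk I r x) :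
    (∃ z ∈ r, x <+: z ∧ ∀ n, z ++ [n] ∈ r → {n} ∈ I) ∨
      ∃ U ≤ r, Cond I U ∧ ∀ s ∈ U, ∀ u ∈ U, s <+: u ∨ u <+: s := by
  by_cases hz : ∃ z ∈ r, x <+: z ∧ ∀ n, z ++ [n] ∈ r → {n} ∈ I
  · exact Or.inl hz
  right
  push Not at hz
  choose! next hnext hpos using hz
  -- Follow successors whose singletons are positive; the resulting branch is then a condition.
  let b : ℕ → List ℕ := fun k => Nat.rec x (fun _ z => z ++ [next z]) k
  have hb : ∀ k, b k ∈ r ∧ x <+: b k := by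
    intro k
    induction k with
    | zero => exact ⟨h.1, List.prefix_rfl⟩
    | succ k ih => exact ⟨hnext _ ih.1 ih.2, ih.2.trans (List.prefix_append _ _)⟩
  have hmono : ∀ k l, k ≤ l → b k <+: b l := by
    intro k l hkl
    induction l, hkl using Nat.le_induction with
    | base => exact List.prefix_rfl
    | succ l _ ih => exact ih.trans (List.prefix_append _ _)
  have hlen : ∀ k, (b k).length = x.length + k := by
    intro k
    induction k with
    | zero => rfl
    | succ k ih =>
      change (b k ++ [next (b k)]).length = _
      simp [ih, add_assoc]
  let U : tree ℕ := ⟨{s | ∃ k, s <+: b k},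
    fun s a ⟨k, hk⟩ => ⟨k, (List.prefix_append _ _).trans hk⟩⟩
  have hcomp : ∀ s ∈ U, ∀ u ∈ U, s <+: u ∨ u <+: s := by
    rintro s ⟨k, hk⟩ u ⟨l, hl⟩
    exact List.prefix_or_prefix_of_prefix (hk.trans (hmono k _ (le_max_left k l)))
      (hl.trans (hmono l _ (le_max_right k l)))
  refine ⟨U, fun s ⟨k, hk⟩ => Tree.mem_of_prefix hk (hb k).1, ⟨x, ⟨0, List.prefix_rfl⟩,
    fun s hs => hcomp s hs x ⟨0, List.prefix_rfl⟩, ?_⟩, hcomp⟩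
  rintro s ⟨k, hk⟩ hxs
  obtain ⟨j, hj⟩ : ∃ j, s = b j := by
    obtain ⟨j, hj⟩ := Nat.exists_eq_add_of_le hxs.length_le
    refine ⟨j, ?_⟩
    have h1 : s <+: b (max k j) := hk.trans (hmono _ _ (le_max_left _ _))
    have h2 : b j <+: b (max k j) := hmono _ _ (le_max_right _ _)
    exact (List.prefix_of_prefix_length_le h1 h2 (by rw [hlen, hj])).eq_of_length
      (by rw [hlen, hj])
  subst hj
  refine positive_mono ?_ (hpos (b j) (hb j).1 (hb j).2)
  rintro n rfl
  exact ⟨j + 1, List.prefix_rfl⟩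

/-! ### Fusion. -/

section Fusion

/-- The pairs (tree, node) met in a fusion: `Y T s` is the set of successors kept at the node `s`
and `nx T s n` is the tree assigned to the successor `s ++ [n]`. -/
inductive Reach (Y : tree ℕ → List ℕ → Set ℕ) (nx : tree ℕ → List ℕ → ℕ → tree ℕ) (S : tree ℕ)
    (x : List ℕ) : tree ℕ → List ℕ → Prop
  | base : Reach Y nx S x S x
  | step {T : tree ℕ} {s : List ℕ} {n : ℕ} (h : Reach Y nx S x T s) (hn : n ∈ Y T s) :
      Reach Y nx S x (nx T s n) (s ++ [n])

variable {Y : tree ℕ → List ℕ → Set ℕ} {nx : tree ℕ → List ℕ → ℕ → tree ℕ} {S : tree ℕ}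
  {x : List ℕ}

theorem Reach.le {T : tree ℕ} {s : List ℕ} (h : Reach Y nx S x T s) : x <+: s := by
  induction h with
  | base => exact List.prefix_rfl
  | step _ _ ih => exact ih.trans (List.prefix_append _ _)

theorem Reach.inversion {T : tree ℕ} {s : List ℕ} (h : Reach Y nx S x T s) :
    (T = S ∧ s = x) ∨
      ∃ T' s' n, Reach Y nx S x T' s' ∧ n ∈ Y T' s' ∧ T = nx T' s' n ∧ s = s' ++ [n] := by
  cases h with
  | base => exact Or.inl ⟨rfl, rfl⟩
  | step h hn => exact Or.inr ⟨_, _, _, h, hn, rfl, rfl⟩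

/-- A node longer than `x` determines its predecessor and its last entry, hence its entire history
in the construction. -/
theorem Reach.unique {T T' : tree ℕ} {s : List ℕ} (h : Reach Y nx S x T s)
    (h' : Reach Y nx S x T' s) : T = T' := by
  induction h generalizing T' with
  | base =>
    rcases h'.inversion with ⟨rfl, -⟩ | ⟨T'', s', n, h1, -, -, h2⟩
    · rfl
    · have := h1.le.length_le
      rw [h2] at this
      simp at this
  | @step T s n h hn ih =>
    rcases h'.inversion with ⟨-, h2⟩ | ⟨T'', s', m, h1, -, h2, h3⟩
    · have := h.le.length_le
      rw [← h2] at this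
      simp at this
    · obtain ⟨rfl, hnm⟩ := List.append_inj' h3 rfl
      obtain rfl : n = m := by simpa using hnm
      rw [h2, ih h1]

/-- The fusion consists of the reached nodes and the initial segments of `x`. Assigned trees shrink
along extensions of nodes, so the part of the fusion through `s` stays inside the tree assigned to
`s`. -/
theorem exists_fusion (Good : tree ℕ → List ℕ → Prop)
    (hY : ∀ T s, Good T s → Trunk I T s ∧ Y T s ∉ I ∧
      ∀ n ∈ Y T s, Good (nx T s n) (s ++ [n]) ∧ nx T s n ≤ T)
    (h0 : Good S x) :
    ∃ q ≤ S, Trunk I q x ∧ ∀ s ∈ q, x <+: s → ∃ T, Good T s ∧ restrict q s ≤ T ∧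
      ∀ n, s ++ [n] ∈ q → n ∈ Y T s ∧ restrict q (s ++ [n]) ≤ nx T s n := by
  have hgood : ∀ T s, Reach Y nx S x T s → Good T s := by
    intro T s h
    induction h with
    | base => exact h0
    | step _ hn ih => exact ((hY _ _ ih).2.2 _ hn).1
  have hmono : ∀ U u, Reach Y nx S x U u → ∀ T s, Reach Y nx S x T s → s <+: u → U ≤ T := by
    intro U u h
    induction h with
    | base =>
      intro T s hs hle
      obtain rfl := hle.eq_of_length_le hs.le.length_le
      exact (Reach.base.unique hs).le
    | @step U u n h hn ih =>
      intro T s hs hle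
      rcases List.prefix_concat_iff.1 hle with rfl | hle
      · exact ((h.step hn).unique hs).le
      · exact ((hY _ _ (hgood _ _ h)).2.2 n hn).2.trans (ih T s hs hle)
  let q : tree ℕ := ⟨{s | s <+: x ∨ ∃ T, Reach Y nx S x T s}, by
    rintro s a (h | ⟨T, h⟩)
    · exact Or.inl ((List.prefix_append _ _).trans h)
    · rcases h.inversion with ⟨-, h⟩ | ⟨T', s', n, h1, -, -, h3⟩
      · exact Or.inl (h ▸ List.prefix_append _ _)
      · obtain ⟨rfl, -⟩ := List.append_inj' h3 rfl
        exact Or.inr ⟨_, h1⟩⟩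
  have hq : ∀ s ∈ q, x <+: s → ∃ T, Reach Y nx S x T s := by
    rintro s (h | h) hx
    · obtain rfl := h.eq_of_length_le hx.length_le
      exact ⟨S, Reach.base⟩
    · exact h
  have hle : ∀ T s, Reach Y nx S x T s → restrict q s ≤ T := by
    rintro T s h u ⟨hu, hus | hsu⟩
    · exact Tree.mem_of_prefix hus (hY _ _ (hgood _ _ h)).1.1
    · obtain ⟨U, hU⟩ := hq u hu (h.le.trans hsu)
      exact hmono U u hU T s h hsu (hY _ _ (hgood _ _ hU)).1.1
  have hx : ∀ s ∈ q, s <+: x ∨ x <+: s := by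
    rintro s (h | ⟨T, h⟩)
    · exact Or.inl h
    · exact Or.inr h.le
  refine ⟨q, ?_, ⟨Or.inl List.prefix_rfl, hx, ?_⟩, ?_⟩
  · intro s hs
    exact hle S x Reach.base ⟨hs, hx s hs⟩
  · intro s hs hxs
    obtain ⟨T, hT⟩ := hq s hs hxs
    exact positive_mono (fun n hn => Or.inr ⟨_, hT.step hn⟩) (hY _ _ (hgood _ _ hT)).2.1
  · intro s hs hxs
    obtain ⟨T, hT⟩ := hq s hs hxs
    refine ⟨T, hgood _ _ hT, hle T s hT, fun n hn => ?_⟩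
    obtain ⟨U, hU⟩ := hq _ hn (hxs.trans (List.prefix_append _ _))
    rcases hU.inversion with ⟨-, h⟩ | ⟨T', s', m, h1, h2, h3, h4⟩
    · have := hxs.length_le
      rw [← h] at this
      simp at this
    · obtain ⟨rfl, hnm⟩ := List.append_inj' h4 rfl
      obtain rfl : n = m := by simpa using hnm
      obtain rfl := hT.unique h1
      exact ⟨h2, hle _ _ (hT.step h2)⟩

end Fusion

end Trees

end YProperness

namespace YProperness

/-! ### Set-theoretic codes of sequences and trees, and formulas about them. -/

section Codes

open Descriptive

/-- The von Neumann natural number `n`. -/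
noncomputable abbrev natCode (n : ℕ) : ZFSet.{u} := Ordinal.toZFSet ((n : ℕ) : Ordinal.{u})

theorem natCode_injective : Function.Injective natCode.{u} := fun m n h => by
  simpa using Ordinal.toZFSet_injective h

theorem mem_seqCode {s : List ℕ} {z : ZFSet.{u}} :
    z ∈ seqCode s ↔ ∃ i n, s[i]? = some n ∧ z = ZFSet.pair (natCode i) (natCode n) := by
  rw [seqCode, ZFSet.mem_range]
  constructor
  · rintro ⟨i, rfl⟩
    exact ⟨i, s.get i, by simp, rfl⟩
  · rintro ⟨i, n, h, rfl⟩
    obtain ⟨hi, rfl⟩ := List.getElem?_eq_some_iff.1 h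
    exact ⟨⟨i, hi⟩, rfl⟩

theorem pair_mem_seqCode {s : List ℕ} {i n : ℕ} :
    ZFSet.pair (natCode.{u} i) (natCode n) ∈ seqCode s ↔ s[i]? = some n := by
  rw [mem_seqCode]
  constructor
  · rintro ⟨j, m, h, e⟩
    obtain ⟨h1, h2⟩ := ZFSet.pair_inj.1 e
    rwa [natCode_injective h1, natCode_injective h2]
  · exact fun h => ⟨i, n, h, rfl⟩

theorem seqCode_subset {s t : List ℕ} : seqCode.{u} s ⊆ seqCode t ↔ s <+: t := by
  constructor
  · intro h
    rw [List.prefix_iff_getElem?]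
    intro i hi
    exact pair_mem_seqCode.1 (h (pair_mem_seqCode.2 (by simp [hi])))
  · intro h z hz
    obtain ⟨i, n, h1, rfl⟩ := mem_seqCode.1 hz
    obtain ⟨hi, rfl⟩ := List.getElem?_eq_some_iff.1 h1
    exact pair_mem_seqCode.2 (List.prefix_iff_getElem?.1 h i hi)

theorem seqCode_injective : Function.Injective seqCode.{u} := fun s t h => by
  have h1 : s <+: t := seqCode_subset.1 (h ▸ fun _ hz => hz)
  have h2 : t <+: s := seqCode_subset.1 (h ▸ fun _ hz => hz)
  exact h1.eq_of_length_le h2.length_le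

theorem seqCode_nil : seqCode.{u} [] = ∅ := by
  rw [ZFSet.eq_empty]
  intro z hz
  obtain ⟨i, n, h, -⟩ := mem_seqCode.1 hz
  simp at h

theorem seqCode_concat (s : List ℕ) (n : ℕ) :
    seqCode.{u} (s ++ [n]) =
      insert (ZFSet.pair (natCode s.length) (natCode n)) (seqCode s) := by
  ext z
  rw [ZFSet.mem_insert_iff]
  constructor
  · intro hz
    obtain ⟨i, m, h, rfl⟩ := mem_seqCode.1 hz
    rcases lt_trichotomy i s.length with hi | rfl | hi
    · rw [List.getElem?_append_left hi] at h
      exact Or.inr (pair_mem_seqCode.2 h)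
    · left
      have : n = m := by simpa using h
      rw [this]
    · rw [List.getElem?_eq_none (by simpa using hi)] at h
      cases h
  · rintro (rfl | hz)
    · exact pair_mem_seqCode.2 (by simp)
    · exact seqCode_subset.2 (List.prefix_append _ _) hz

theorem mem_treeCode {T : tree ℕ} {z : ZFSet.{u}} :
    z ∈ treeCode T ↔ ∃ s ∈ T, seqCode s = z := by
  rw [treeCode, ZFSet.mem_range]
  exact ⟨fun ⟨s, h⟩ => ⟨s.1, s.2, h⟩, fun ⟨s, hs, h⟩ => ⟨⟨s, hs⟩, h⟩⟩

theorem seqCode_mem_treeCode {T : tree ℕ} {s : List ℕ} : seqCode.{u} s ∈ treeCode T ↔ s ∈ T := by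
  rw [mem_treeCode]
  exact ⟨fun ⟨t, ht, e⟩ => seqCode_injective e ▸ ht, fun h => ⟨s, h, rfl⟩⟩

theorem treeCode_subset {T T' : tree ℕ} : treeCode.{u} T ⊆ treeCode T' ↔ T ≤ T' := by
  constructor
  · exact fun h s hs => seqCode_mem_treeCode.1 (h (seqCode_mem_treeCode.2 hs))
  · intro h z hz
    obtain ⟨s, hs, rfl⟩ := mem_treeCode.1 hz
    exact seqCode_mem_treeCode.2 (h hs)

theorem treeCode_injective : Function.Injective treeCode.{u} := fun _ _ h =>
  le_antisymm (treeCode_subset.1 (h ▸ fun _ hz => hz)) (treeCode_subset.1 (h ▸ fun _ hz => hz))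

theorem mem_treeSet {C : Set (tree ℕ)} {z : ZFSet.{u}} :
    z ∈ treeSet C ↔ ∃ T ∈ C, treeCode T = z := by
  rw [treeSet, ZFSet.mem_range]
  exact ⟨fun ⟨s, h⟩ => ⟨s.1, s.2, h⟩, fun ⟨s, hs, h⟩ => ⟨⟨s, hs⟩, h⟩⟩

theorem treeCode_mem_treeSet {C : Set (tree ℕ)} {T : tree ℕ} :
    treeCode.{u} T ∈ treeSet C ↔ T ∈ C := by
  rw [mem_treeSet]
  exact ⟨fun ⟨t, ht, e⟩ => treeCode_injective e ▸ ht, fun h => ⟨T, h, rfl⟩⟩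

/-- `w` and `z` are ordered pairs with the same second coordinate. -/
def SameSnd (w z : ZFSet.{u}) : Prop :=
  ∃ e ∈ w, ∃ i ∈ e, ∃ n ∈ e, ∃ e' ∈ z, ∃ j ∈ e', w = ZFSet.pair i n ∧ z = ZFSet.pair j n

theorem sameSnd_pair {i m j n : ZFSet.{u}} :
    SameSnd (ZFSet.pair i m) (ZFSet.pair j n) ↔ m = n := by
  constructor
  · rintro ⟨_, -, _, -, _, -, _, -, _, -, h1, h2⟩
    rw [(ZFSet.pair_inj.1 h1).2, (ZFSet.pair_inj.1 h2).2]
  · rintro rfl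
    refine ⟨{i, m}, ?_, i, ?_, m, ?_, {j, m}, ?_, j, ?_, rfl, rfl⟩ <;> simp [ZFSet.pair]

/-- `v` extends `s` by the single element `w`. -/
def ExtendsBy (s v w : ZFSet.{u}) : Prop :=
  s ⊆ v ∧ w ∉ s ∧ ∀ w' ∈ v, w' ∈ s ∨ w' = w

/-- `v` is an immediate successor of the node `s`. -/
def IsSucc (s v : ZFSet.{u}) : Prop := ∃ w ∈ v, ExtendsBy s v w

theorem extendsBy_seqCode {s v : List ℕ} {w : ZFSet.{u}} (hw : w ∈ seqCode v) :
    ExtendsBy (seqCode s) (seqCode v) w ↔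
      ∃ n, v = s ++ [n] ∧ w = ZFSet.pair (natCode s.length) (natCode n) := by
  constructor
  · rintro ⟨h1, h2, h3⟩
    obtain ⟨l, rfl⟩ := seqCode_subset.1 h1
    cases l with
    | nil => exact absurd (by simpa using hw) h2
    | cons n l =>
      have hnew : ∀ i, s.length ≤ i → ∀ m,
          ZFSet.pair (natCode.{u} i) (natCode m) ∉ seqCode s := by
        intro i hi m h
        rw [pair_mem_seqCode, List.getElem?_eq_none hi] at h
        cases h
      have e1 := (h3 (ZFSet.pair (natCode s.length) (natCode n))
        (pair_mem_seqCode.2 (by simp))).resolve_left (hnew _ le_rfl _)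
      cases l with
      | nil => exact ⟨n, rfl, e1.symm⟩
      | cons m l =>
        have e2 := (h3 (ZFSet.pair (natCode (s.length + 1)) (natCode m))
          (pair_mem_seqCode.2 (by simp))).resolve_left (hnew _ (Nat.le_succ _) _)
        have := natCode_injective (ZFSet.pair_inj.1 (e2.trans e1.symm)).1
        omega
  · rintro ⟨n, rfl, rfl⟩
    refine ⟨seqCode_subset.2 (List.prefix_append _ _), fun h => ?_, fun w' hw' => ?_⟩
    · rw [pair_mem_seqCode, List.getElem?_eq_none le_rfl] at h
      cases h
    · rw [seqCode_concat, ZFSet.mem_insert_iff] at hw'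
      exact hw'.symm

theorem isSucc_seqCode {s v : List ℕ} :
    IsSucc (seqCode.{u} s) (seqCode v) ↔ ∃ n, v = s ++ [n] := by
  constructor
  · rintro ⟨w, hw, h⟩
    obtain ⟨n, h, -⟩ := (extendsBy_seqCode hw).1 h
    exact ⟨n, h⟩
  · rintro ⟨n, rfl⟩
    have : ZFSet.pair (natCode.{u} s.length) (natCode n) ∈ seqCode (s ++ [n]) :=
      pair_mem_seqCode.2 (by simp)
    exact ⟨_, this, (extendsBy_seqCode this).2 ⟨n, rfl, rfl⟩⟩

/-- The set-theoretic expression that the splitting set of `T` at `s` is positive: it contains all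
the values of the members of some tree in `C`. -/
def PosZ (C T s : ZFSet.{u}) : Prop :=
  ∃ T' ∈ C, ∀ u ∈ T', ∀ z ∈ u, ∃ v ∈ T, ∃ w ∈ v, ExtendsBy s v w ∧ SameSnd w z

/-- The set-theoretic expression that `t` is a trunk of `T`. -/
def TrunkZ (C T t : ZFSet.{u}) : Prop :=
  t ∈ T ∧ (∀ s ∈ T, s ⊆ t ∨ t ⊆ s) ∧ ∀ s ∈ T, t ⊆ s → PosZ C T s

/-- The set of conditions of `P(I)`. -/
noncomputable abbrev condSet (I : Order.Ideal (Set ℕ)) : ZFSet.{u} := (idealForcing.{u} I).carrier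

variable {I : Order.Ideal (Set ℕ)}

theorem treeCode_mem_condSet {T : tree ℕ} : treeCode.{u} T ∈ condSet I ↔ Cond I T :=
  treeCode_mem_treeSet

theorem mem_condSet {z : ZFSet.{u}} : z ∈ condSet I ↔ ∃ T, Cond I T ∧ treeCode T = z :=
  mem_treeSet

theorem idealForcing_le {p q : ZFSet.{u}} :
    (idealForcing.{u} I).Le q p ↔ q ∈ condSet I ∧ p ∈ condSet I ∧ q ⊆ p := by
  change ZFSet.pair q p ∈ ZFSet.pairSep (fun S T => S ⊆ T) (condSet I) (condSet I) ↔ _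
  rw [ZFSet.mem_pairSep]
  constructor
  · rintro ⟨a, ha, b, hb, e, h⟩
    obtain ⟨rfl, rfl⟩ := ZFSet.pair_inj.1 e
    exact ⟨ha, hb, h⟩
  · rintro ⟨h1, h2, h3⟩
    exact ⟨q, h1, p, h2, rfl, h3⟩

/-- Only the poset is known to belong to the submodel, so positivity has to be read off from the
conditions. The successors of the trunk of any condition `T'` form a positive set of values;
conversely, for a positive set, all finite sequences with values in it form a condition. -/
theorem posZ_iff {T : tree ℕ} {s : List ℕ} :
    PosZ (condSet.{u} I) (treeCode T) (seqCode s) ↔ {n | s ++ [n] ∈ T} ∉ I := by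
  constructor
  · rintro ⟨T', hT', h⟩
    obtain ⟨T₀, ⟨t, ht⟩, rfl⟩ := mem_condSet.1 hT'
    refine positive_mono ?_ (ht.2.2 t ht.1 List.prefix_rfl)
    intro n hn
    obtain ⟨v, hv, w, hw, hext, hsame⟩ := h _ (seqCode_mem_treeCode.2 hn)
      (ZFSet.pair (natCode t.length) (natCode n)) (pair_mem_seqCode.2 (by simp))
    obtain ⟨v, hvT, rfl⟩ := mem_treeCode.1 hv
    obtain ⟨m, rfl, rfl⟩ := (extendsBy_seqCode hw).1 hext
    obtain rfl := natCode_injective (sameSnd_pair.1 hsame)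
    exact hvT
  · intro h
    let T' : tree ℕ := ⟨{u | ∀ n ∈ u, s ++ [n] ∈ T},
      fun x a hx n hn => hx n (List.mem_append_left _ hn)⟩
    have hT' : Trunk I T' [] := by
      refine ⟨fun n hn => by simp at hn, fun u _ => Or.inr List.nil_prefix, fun u hu _ => ?_⟩
      refine positive_mono (fun n hn m hm => ?_) h
      rcases List.mem_append.1 hm with hm | hm
      · exact hu m hm
      · rw [List.mem_singleton.1 hm]
        exact hn
    refine ⟨treeCode T', treeCode_mem_condSet.2 ⟨[], hT'⟩, fun u hu z hz => ?_⟩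
    obtain ⟨u, huT, rfl⟩ := mem_treeCode.1 hu
    obtain ⟨i, n, hi, rfl⟩ := mem_seqCode.1 hz
    have hn : s ++ [n] ∈ T := huT n (List.mem_of_getElem? hi)
    have hw : ZFSet.pair (natCode.{u} s.length) (natCode n) ∈ seqCode (s ++ [n]) :=
      pair_mem_seqCode.2 (by simp)
    exact ⟨_, seqCode_mem_treeCode.2 hn, _, hw, (extendsBy_seqCode hw).2 ⟨n, rfl, rfl⟩,
      sameSnd_pair.2 rfl⟩

theorem trunkZ_iff {T : tree ℕ} {t : List ℕ} :
    TrunkZ (condSet.{u} I) (treeCode T) (seqCode t) ↔ Trunk I T t := by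
  constructor
  · rintro ⟨h1, h2, h3⟩
    refine ⟨seqCode_mem_treeCode.1 h1, fun s hs => ?_, fun s hs hts => ?_⟩
    · exact (h2 _ (seqCode_mem_treeCode.2 hs)).imp seqCode_subset.1 seqCode_subset.1
    · exact posZ_iff.1 (h3 _ (seqCode_mem_treeCode.2 hs) (seqCode_subset.2 hts))
  · rintro ⟨h1, h2, h3⟩
    refine ⟨seqCode_mem_treeCode.2 h1, fun s hs => ?_, fun s hs hts => ?_⟩
    · obtain ⟨s, hsT, rfl⟩ := mem_treeCode.1 hs
      exact (h2 _ hsT).imp seqCode_subset.2 seqCode_subset.2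
    · obtain ⟨s, hsT, rfl⟩ := mem_treeCode.1 hs
      exact posZ_iff.2 (h3 _ hsT (seqCode_subset.1 hts))

section Definability

variable {θ : Cardinal.{u}} {N : setLanguage.ElementarySubstructure (H θ)}
  {f g k : (ℕ → H θ) → ZFSet.{u}}

theorem Dfn.sameSnd (hf : Tm N f) (hg : Tm N g) : Dfn N (fun v => SameSnd (f v) (g v)) := by
  unfold SameSnd
  exact Dfn.bex hf (Dfn.bex (Tm.var 0) (Dfn.bex (Tm.var 1) (Dfn.bex hg.tail.tail.tail
    (Dfn.bex (Tm.var 0) (Dfn.and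
      (Dfn.eq_pair hf.tail.tail.tail.tail.tail (Tm.var 3) (Tm.var 2))
      (Dfn.eq_pair hg.tail.tail.tail.tail.tail (Tm.var 0) (Tm.var 2)))))))

theorem Dfn.extendsBy (hf : Tm N f) (hg : Tm N g) (hk : Tm N k) :
    Dfn N (fun v => ExtendsBy (f v) (g v) (k v)) := by
  unfold ExtendsBy
  exact Dfn.and (Dfn.subset hf hg) (Dfn.and (Dfn.not (Dfn.mem hk hf))
    (Dfn.ball hg (Dfn.or (Dfn.mem (Tm.var 0) hf.tail) (Dfn.eq (Tm.var 0) hk.tail))))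

theorem Dfn.isSucc (hf : Tm N f) (hg : Tm N g) : Dfn N (fun v => IsSucc (f v) (g v)) := by
  unfold IsSucc
  exact Dfn.bex hg (Dfn.extendsBy hf.tail hg.tail (Tm.var 0))

theorem Dfn.posZ (hf : Tm N f) (hg : Tm N g) (hk : Tm N k) :
    Dfn N (fun v => PosZ (f v) (g v) (k v)) := by
  unfold PosZ
  exact Dfn.bex hf (Dfn.ball (Tm.var 0) (Dfn.ball (Tm.var 0) (Dfn.bex hg.tail.tail.tail
    (Dfn.bex (Tm.var 0) (Dfn.and
      (Dfn.extendsBy hk.tail.tail.tail.tail.tail (Tm.var 1) (Tm.var 0))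
      (Dfn.sameSnd (Tm.var 0) (Tm.var 2)))))))

theorem Dfn.trunkZ (hf : Tm N f) (hg : Tm N g) (hk : Tm N k) :
    Dfn N (fun v => TrunkZ (f v) (g v) (k v)) := by
  unfold TrunkZ
  exact Dfn.and (Dfn.mem hk hg) (Dfn.and
    (Dfn.ball hg (Dfn.or (Dfn.subset (Tm.var 0) hk.tail) (Dfn.subset hk.tail (Tm.var 0))))
    (Dfn.ball hg (Dfn.imp (Dfn.subset hk.tail (Tm.var 0))
      (Dfn.posZ hf.tail hg.tail (Tm.var 0)))))

end Definability

end Codes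

end YProperness

namespace YProperness

/-! ### Ultrafilters on `RO(P)`. -/

namespace SetPoset

variable {P : SetPoset.{u}}

theorem mem_RO {b : ZFSet.{u}} : b ∈ P.RO ↔ P.IsRegularOpen b :=
  ZFSet.mem_sep.trans ⟨fun h => h.2, fun h => ⟨ZFSet.mem_powerset.2 h.1, h⟩⟩

theorem carrier_mem_RO : P.carrier ∈ P.RO :=
  mem_RO.2 ⟨fun _ h => h, fun _ _ _ hq _ => hq, fun _ hp _ => hp⟩

theorem inter_mem_RO {a b : ZFSet.{u}} (ha : a ∈ P.RO) (hb : b ∈ P.RO) : a ∩ b ∈ P.RO := by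
  rw [mem_RO] at *
  refine ⟨fun z hz => ha.1 (ZFSet.mem_inter.1 hz).1, fun p hp q hq hqp => ?_, fun p hp h => ?_⟩
  · rw [ZFSet.mem_inter] at *
    exact ⟨ha.2.1 p hp.1 q hq hqp, hb.2.1 p hp.2 q hq hqp⟩
  · refine ZFSet.mem_inter.2 ⟨ha.2.2 p hp fun q hq hqp => ?_, hb.2.2 p hp fun q hq hqp => ?_⟩
    · obtain ⟨r, hr, h'⟩ := h q hq hqp
      exact ⟨r, (ZFSet.mem_inter.1 hr).1, h'⟩
    · obtain ⟨r, hr, h'⟩ := h q hq hqp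
      exact ⟨r, (ZFSet.mem_inter.1 hr).2, h'⟩

variable (P) in
/-- The conditions having no stronger condition in `b`. -/
def compl (b : ZFSet.{u}) : ZFSet.{u} :=
  ZFSet.sep (fun p => ∀ q ∈ P.carrier, P.Le q p → q ∉ b) P.carrier

theorem mem_compl {b p : ZFSet.{u}} :
    p ∈ P.compl b ↔ p ∈ P.carrier ∧ ∀ q ∈ P.carrier, P.Le q p → q ∉ b := ZFSet.mem_sep

theorem compl_mem_RO {b : ZFSet.{u}} (hb : b ∈ P.RO) : P.compl b ∈ P.RO := by
  rw [mem_RO] at *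
  refine ⟨fun z hz => (mem_compl.1 hz).1, fun p hp q hq hqp => ?_, fun p hp h => ?_⟩
  · rw [mem_compl] at *
    exact ⟨hq, fun r hr hrq => hp.2 r hr (P.trans _ _ _ hrq hqp)⟩
  · refine mem_compl.2 ⟨hp, fun q hq hqp hqb => ?_⟩
    obtain ⟨r, hr, hrq⟩ := h q hq hqp
    have hrC := (mem_compl.1 hr).1
    exact (mem_compl.1 hr).2 r hrC (P.refl r hrC) (hb.2.1 q hqb r hrC hrq)

/-- A filter on `RO(P)` is an ultrafilter if every regular open set outside of it is disjoint from
some member. -/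
def IsUltra (P : SetPoset.{u}) (F : ZFSet.{u}) : Prop :=
  P.IsFilterRO F ∧ ∀ b ∈ P.RO, b ∉ F → ∃ b' ∈ F, ∀ z ∈ b, z ∉ b'

/-- An ultrafilter on `RO(P)` avoiding a given ideal. -/
theorem exists_ultra (null : ZFSet.{u} → Prop) (hunit : ¬ null P.carrier) (hzero : null ∅)
    (hmono : ∀ a b, a ⊆ b → null b → null a)
    (hsplit : ∀ a ∈ P.RO, ∀ b ∈ P.RO, null (a ∩ b) → null (a ∩ P.compl b) → null a) :
    ∃ F, P.IsUltra F ∧ ∀ a ∈ F, ¬ null a := by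
  -- Families of non-null regular open sets closed under intersection; a maximal one turns out to be
  -- an ultrafilter.
  let 𝒮 : Set (Set ZFSet.{u}) := {A | (∀ a ∈ A, a ∈ P.RO ∧ ¬ null a) ∧
    ∀ a ∈ A, ∀ b ∈ A, a ∩ b ∈ A}
  have hstart : {P.carrier} ∈ 𝒮 := by
    refine ⟨?_, ?_⟩
    · rintro a rfl
      exact ⟨carrier_mem_RO, hunit⟩
    · rintro a rfl b rfl
      exact ZFSet.inter_eq_left_of_subset fun _ h => h
  obtain ⟨A, hCA, hA⟩ := zorn_subset_nonempty 𝒮 (by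
    intro c hc hchain hne
    refine ⟨⋃₀ c, ⟨?_, ?_⟩, fun s hs => Set.subset_sUnion_of_mem hs⟩
    · rintro a ⟨s, hs, ha⟩
      exact (hc hs).1 a ha
    · rintro a ⟨s, hs, ha⟩ b ⟨t, ht, hb⟩
      rcases hchain.total hs ht with h | h
      · exact ⟨t, ht, (hc ht).2 a (h ha) b hb⟩
      · exact ⟨s, hs, (hc hs).2 a ha b (h hb)⟩) _ hstart
  have hC : P.carrier ∈ A := hCA rfl
  have hinter := hA.prop.2
  have hmem : ∀ b ∈ P.RO, (∀ a ∈ A, ¬ null (a ∩ b)) → b ∈ A := by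
    intro b hb h
    -- The filter generated by `A` and `b` is still free of null sets, so maximality puts `b` into
    -- `A`.
    have hA' : {e | e ∈ P.RO ∧ ∃ a ∈ A, a ∩ b ⊆ e} ∈ 𝒮 := by
      refine ⟨fun e ⟨he, a, ha, hae⟩ => ⟨he, fun hn => h a ha (hmono _ _ hae hn)⟩, ?_⟩
      rintro e ⟨he, a, ha, hae⟩ e' ⟨he', a', ha', hae'⟩
      refine ⟨inter_mem_RO he he', a ∩ a', hinter a ha a' ha', fun z hz => ?_⟩
      simp only [ZFSet.mem_inter] at hz ⊢
      exact ⟨hae (ZFSet.mem_inter.2 ⟨hz.1.1, hz.2⟩), hae' (ZFSet.mem_inter.2 ⟨hz.1.2, hz.2⟩)⟩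
    refine hA.le_of_ge hA' (fun e he => ⟨(hA.prop.1 e he).1, e, he, fun z hz =>
      (ZFSet.mem_inter.1 hz).1⟩) ⟨hb, P.carrier, hC, fun z hz => (ZFSet.mem_inter.1 hz).2⟩
  have hF : ∀ a, a ∈ ZFSet.sep (· ∈ A) P.RO ↔ a ∈ A := fun a =>
    ZFSet.mem_sep.trans ⟨fun h => h.2, fun h => ⟨(hA.prop.1 a h).1, h⟩⟩
  refine ⟨ZFSet.sep (· ∈ A) P.RO, ⟨⟨ZFSet.sep_subset, (hF _).2 hC, fun h =>
    (hA.prop.1 _ ((hF _).1 h)).2 hzero, ?_, ?_⟩, ?_⟩, fun a ha => (hA.prop.1 a ((hF a).1 ha)).2⟩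
  · intro a ha b hb hab
    rw [hF] at *
    refine hmem b hb fun a' ha' hn => (hA.prop.1 _ (hinter a' ha' a ha)).2 (hmono _ _ ?_ hn)
    intro z hz
    rw [ZFSet.mem_inter] at *
    exact ⟨hz.1, hab hz.2⟩
  · intro a ha b hb
    rw [hF] at *
    exact hinter a ha b hb
  · intro b hb hbF
    rw [hF] at hbF
    refine ⟨P.compl b, (hF _).2 ?_, fun z hz hz' => ?_⟩
    · by_contra hcF
      have h1 : ∃ a ∈ A, null (a ∩ b) := by
        by_contra h
        push Not at h
        exact hbF (hmem b hb h)
      have h2 : ∃ a ∈ A, null (a ∩ P.compl b) := by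
        by_contra h
        push Not at h
        exact hcF (hmem _ (compl_mem_RO hb) h)
      obtain ⟨a, ha, hab⟩ := h1
      obtain ⟨a', ha', hab'⟩ := h2
      have haa := hinter a ha a' ha'
      refine (hA.prop.1 _ haa).2 (hsplit _ (hA.prop.1 _ haa).1 b hb (hmono _ _ ?_ hab)
        (hmono _ _ ?_ hab'))
      · intro z hz
        simp only [ZFSet.mem_inter] at *
        exact ⟨hz.1.1, hz.2⟩
      · intro z hz
        simp only [ZFSet.mem_inter] at *
        exact ⟨hz.1.2, hz.2⟩
    · obtain ⟨hzC, h⟩ := mem_compl.1 hz'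
      exact h z hzC (P.refl z hzC) hz

end SetPoset

/-- The complement of an `F_σ` ideal has pseudo-intersections. -/
theorem IsFSigmaIdeal.exists_pseudoIntersection {J : Order.Ideal (Set ℕ)} (hJ : IsFSigmaIdeal J)
    {c : ℕ → Set ℕ} (hc : Antitone c) (hpos : ∀ m, c m ∉ J) :
    ∃ y, y ∉ J ∧ y ⊆ c 0 ∧ ∀ m, (y \ c m).Finite := by
  obtain ⟨K, hK, hJK⟩ := hJ
  -- No member of `K m` codes a superset of the positive set `c m`, so each omits a point of `c m`;
  -- by compactness finitely many points suffice for all of `K m`. The union of these finite sets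
  -- then escapes every `K m`.
  have hstep : ∀ m, ∃ a ⊆ c m, a.Finite ∧ ∀ x ∈ K m, ∃ n ∈ a, x n = false := by
    intro m
    have hcover : K m ⊆ ⋃ n ∈ c m, {x : ℕ → Bool | x n = false} := by
      intro x hx
      by_contra h
      have hxJ : x ∈ {x : ℕ → Bool | {n : ℕ | x n = true} ∈ J} := hJK ▸ Set.mem_iUnion.2 ⟨m, hx⟩
      refine hpos m (J.lower (fun n hn => ?_) hxJ)
      simp only [Set.mem_iUnion, not_exists] at h
      exact Bool.eq_true_of_not_eq_false (h n hn)
    have hopen : ∀ n ∈ c m, IsOpen {x : ℕ → Bool | x n = false} := fun n _ =>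
      (isClopen_discrete {false}).isOpen.preimage (f := fun x : ℕ → Bool => x n)
        (continuous_apply n)
    obtain ⟨a, ha, hfin, hKa⟩ := (hK m).isCompact.elim_finite_subcover_image hopen hcover
    refine ⟨a, ha, hfin, fun x hx => ?_⟩
    obtain ⟨n, hn, hxn⟩ := Set.mem_iUnion₂.1 (hKa hx)
    exact ⟨n, hn, hxn⟩
  choose a hac hfin hKa using hstep
  refine ⟨⋃ m, a m, fun hy => ?_, Set.iUnion_subset fun m => (hac m).trans (hc (Nat.zero_le m)),
    fun m => ?_⟩
  · classical
    have : (fun n => decide (n ∈ ⋃ m, a m)) ∈ {x : ℕ → Bool | {n : ℕ | x n = true} ∈ J} := by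
      have e : {n | decide (n ∈ ⋃ m, a m) = true} = ⋃ m, a m := by
        ext
        simp
      rwa [Set.mem_ofPred_eq, e]
    rw [hJK, Set.mem_iUnion] at this
    obtain ⟨m, hm⟩ := this
    obtain ⟨n, hn, hf⟩ := hKa m _ hm
    exact of_decide_eq_false hf (Set.mem_iUnion.2 ⟨m, hn⟩)
  · refine ((Set.finite_lt_nat m).biUnion fun j _ => hfin j).subset ?_
    rintro n ⟨hn, hnm⟩
    obtain ⟨j, hj⟩ := Set.mem_iUnion.1 hn
    refine Set.mem_biUnion (show j < m from ?_) hj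
    by_contra hjm
    exact hnm (hc (not_lt.1 hjm) (hac j hj))

/-! ### Ultrafilters whose countable subfamilies are captured by one condition. -/

section Ideal

open Descriptive

variable {I : Order.Ideal (Set ℕ)}

theorem isRegularOpen_iff {b : ZFSet.{u}} : (idealForcing.{u} I).IsRegularOpen b ↔
    b ⊆ condSet I ∧ (∀ p ∈ b, ∀ q ∈ condSet I, q ⊆ p → q ∈ b) ∧
      ∀ p ∈ condSet I, (∀ q ∈ condSet I, q ⊆ p → ∃ r ∈ b, r ⊆ q) → p ∈ b := by
  simp only [SetPoset.IsRegularOpen, idealForcing_le]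
  constructor
  · rintro ⟨h1, h2, h3⟩
    refine ⟨h1, fun p hp q hq hqp => h2 p hp q hq ⟨hq, h1 hp, hqp⟩, fun p hp h =>
      h3 p hp fun q hq hqp => ?_⟩
    obtain ⟨r, hr, hrq⟩ := h q hq hqp.2.2
    exact ⟨r, hr, h1 hr, hq, hrq⟩
  · rintro ⟨h1, h2, h3⟩
    refine ⟨h1, fun p hp q hq hqp => h2 p hp q hq hqp.2.2, fun p hp h =>
      h3 p hp fun q hq hqp => ?_⟩
    obtain ⟨r, hr, hrq⟩ := h q hq ⟨hq, hp, hqp⟩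
    exact ⟨r, hr, hrq.2.2⟩

theorem RO_down {b : ZFSet.{u}} (hb : b ∈ (idealForcing.{u} I).RO) {G G' : tree ℕ}
    (hG : treeCode G ∈ b) (hle : G' ≤ G) (hG' : Cond I G') : treeCode G' ∈ b :=
  (isRegularOpen_iff.1 (SetPoset.mem_RO.1 hb)).2.1 _ hG _ (treeCode_mem_condSet.2 hG')
    (treeCode_subset.2 hle)

theorem RO_decision {b : ZFSet.{u}} (hb : b ∈ (idealForcing.{u} I).RO) {G : tree ℕ} {y : List ℕ}
    (hG : Trunk I G y) : ∃ G' ≤ G, Trunk I G' y ∧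
      (treeCode G' ∈ b ∨ treeCode G' ∈ (idealForcing.{u} I).compl b) := by
  obtain ⟨h1, -, h3⟩ := isRegularOpen_iff.1 (SetPoset.mem_RO.1 hb)
  obtain ⟨G', hle, ht, h⟩ := pure_decision (I := I) (B := {T | treeCode T ∈ b})
    (fun G hG G' hle hG' => RO_down hb hG hle hG')
    (fun G hG h => h3 _ (treeCode_mem_condSet.2 hG) fun q hq hqG => by
      obtain ⟨G', hG', rfl⟩ := mem_condSet.1 hq
      obtain ⟨G'', hle, hmem⟩ := h G' (treeCode_subset.1 hqG) hG'
      exact ⟨_, hmem, treeCode_subset.2 hle⟩)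
    (fun G hG => treeCode_mem_condSet.1 (h1 hG)) hG
  refine ⟨G', hle, ht, h.imp id fun h => SetPoset.mem_compl.2
    ⟨treeCode_mem_condSet.2 ⟨y, ht⟩, fun q hq hqG hqb => ?_⟩⟩
  obtain ⟨G'', -, rfl⟩ := mem_condSet.1 hq
  exact h G'' (treeCode_subset.1 (idealForcing_le.1 hqG).2.2) hqb

/-- `R`, a condition with the same trunk `x` as `S`, is such that every condition with trunk `x`
whose immediate successors of `x` are taken from `R` has an immediate successor of `x` which is
the trunk of some member of `b` below `S`. -/
def Captures (I : Order.Ideal (Set ℕ)) (S R : tree ℕ) (x : List ℕ) (b : ZFSet.{u}) : Prop :=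
  ∀ R' ≤ S, Trunk I R' x → (∀ n, x ++ [n] ∈ R' → x ++ [n] ∈ R) →
    ∃ n, x ++ [n] ∈ R' ∧ ∃ G ≤ S, treeCode G ∈ b ∧ Trunk I G (x ++ [n])

theorem exists_ultra_captures (hI : IsIntersectionOfFSigmaIdeals I) {S : tree ℕ} {x : List ℕ}
    (hS : Trunk I S x) (hpos : {n | x ++ [n] ∈ S ∧ {n} ∈ I} ∉ I) :
    ∃ F, (idealForcing.{u} I).IsUltra F ∧ ∀ B : Set ZFSet.{u}, B.Countable → (∀ b ∈ B, b ∈ F) →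
      ∃ R ≤ S, Trunk I R x ∧ ∀ b ∈ B, Captures I S R x b := by
  obtain ⟨𝒥, h𝒥, hI𝒥⟩ := hI
  obtain ⟨J, hJ, hposJ⟩ : ∃ J ∈ 𝒥, {n | x ++ [n] ∈ S ∧ {n} ∈ I} ∉ J := by
    by_contra h
    push Not at h
    exact hpos ((hI𝒥 _).2 h)
  let c : ZFSet.{u} → Set ℕ := fun b =>
    {n | {n} ∈ I ∧ ∃ G ≤ S, treeCode G ∈ b ∧ Trunk I G (x ++ [n])}
  have hcmono : ∀ a b, a ⊆ b → c a ⊆ c b := fun a b hab n ⟨h1, G, h2, h3, h4⟩ =>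
    ⟨h1, G, h2, hab h3, h4⟩
  obtain ⟨F, hF, hFpos⟩ := SetPoset.exists_ultra (P := idealForcing.{u} I) (fun b => c b ∈ J)
    (positive_mono (by
      intro n hn
      have ht := trunk_restrict hS hn.1 (List.prefix_append _ _)
      exact ⟨hn.2, restrict S (x ++ [n]), restrict_le _ _, treeCode_mem_condSet.2 ⟨_, ht⟩, ht⟩)
      hposJ)
    (J.lower (b := c ∅) (by
      rintro n ⟨-, G, -, h, -⟩
      exact (ZFSet.notMem_empty _ h).elim)
      J.bot_mem)
    (fun a b hab hb => J.lower (hcmono a b hab) hb)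
    (fun a ha b hb h1 h2 => by
      refine J.lower ?_ (union_mem_ideal h1 h2)
      rintro n ⟨hn, G, hGS, hGa, hGt⟩
      obtain ⟨G', hle, hG't, hG'⟩ := RO_decision hb hGt
      have hG'a := RO_down ha hGa hle ⟨_, hG't⟩
      rcases hG' with h | h
      · exact Or.inl ⟨hn, G', hle.trans hGS, ZFSet.mem_inter.2 ⟨hG'a, h⟩, hG't⟩
      · exact Or.inr ⟨hn, G', hle.trans hGS, ZFSet.mem_inter.2 ⟨hG'a, h⟩, hG't⟩)
  refine ⟨F, hF, fun B hB hBF => ?_⟩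
  -- The unit of `RO(P)` is added so that there is something to enumerate even when `B` is empty.
  obtain ⟨e, he⟩ := (hB.insert (condSet I)).exists_eq_range (Set.insert_nonempty _ _)
  have heF : ∀ k, e k ∈ F := by
    intro k
    have : e k ∈ insert (condSet I) B := he ▸ Set.mem_range_self k
    rcases this with h | h
    · rw [h]
      exact hF.1.2.1
    · exact hBF _ h
  let d : ℕ → ZFSet.{u} := fun k => Nat.rec (e 0) (fun k a => a ∩ e (k + 1)) k
  have hdF : ∀ k, d k ∈ F := by
    intro k
    induction k with
    | zero => exact heF 0
    | succ k ih => exact hF.1.2.2.2.2 _ ih _ (heF _)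
  have hde : ∀ k, d k ⊆ e k := by
    intro k
    cases k with
    | zero => exact fun _ h => h
    | succ k => exact fun z hz => (ZFSet.mem_inter.1 hz).2
  have hanti : Antitone fun k => c (d k) :=
    antitone_nat_of_succ_le fun k => hcmono _ _ fun z hz => (ZFSet.mem_inter.1 hz).1
  obtain ⟨y, hyJ, hy0, hyfin⟩ := (h𝒥 J hJ).exists_pseudoIntersection hanti
    fun m => hFpos _ (hdF m)
  have hyI : y ∉ I := fun h => hyJ ((hI𝒥 y).1 h J hJ)
  have hyS : ∀ n ∈ y, x ++ [n] ∈ S := fun n hn => by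
    obtain ⟨-, G, hGS, -, hGt⟩ := hy0 hn
    exact hGS hGt.1
  obtain ⟨R, hRS, hRt, hRy⟩ := hS.exists_prune hyI hyS
  refine ⟨R, hRS, hRt, fun b hb R' hR'S hR't hR'R => ?_⟩
  obtain ⟨m, rfl⟩ : ∃ m, e m = b := by
    have : b ∈ Set.range e := he ▸ Set.mem_insert_of_mem _ hb
    exact this
  have hne : ∃ n, x ++ [n] ∈ R' ∧ n ∈ c (d m) := by
    by_contra h
    push Not at h
    -- Otherwise the successors of `x` in `R'` would lie in the finite set `y \ c (d m)`, which is
    -- in `I` because the singletons of points of `y` are.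
    refine positive_mono (b := y \ c (d m)) ?_ (hR't.2.2 x hR't.1 List.prefix_rfl)
      (finite_mem_ideal (hyfin m) fun n hn => (hy0 hn.1).1)
    intro n hn
    exact ⟨hRy n (hR'R n hn), h n hn⟩
  obtain ⟨n, hn, -, G, hGS, hGd, hGt⟩ := hne
  exact ⟨n, hn, G, hGS, hde m hGd, hGt⟩

end Ideal

end YProperness

namespace YProperness

/-! ### Formulas for filters, regular open sets and capturing. -/

section Definability

variable {θ : Cardinal.{u}} {N : setLanguage.ElementarySubstructure (H θ)}
  {f g k l m : (ℕ → H θ) → ZFSet.{u}} {P : SetPoset.{u}} {I : Order.Ideal (Set ℕ)}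

theorem Dfn.eq_inter (hf : Tm N f) (hg : Tm N g) (hk : Tm N k) :
    Dfn N (fun v => f v = g v ∩ k v) := by
  refine (Dfn.and (Dfn.ball (φ := fun v x => x ∈ g v ∧ x ∈ k v) hf
      (Dfn.and (Dfn.mem (Tm.var 0) hg.tail) (Dfn.mem (Tm.var 0) hk.tail)))
    (Dfn.ball (φ := fun v x => x ∈ k v → x ∈ f v) hg
      (Dfn.imp (Dfn.mem (Tm.var 0) hk.tail) (Dfn.mem (Tm.var 0) hf.tail)))).congr fun v => ?_
  rw [ZFSet.ext_iff]
  simp only [ZFSet.mem_inter]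
  exact ⟨fun h z => ⟨h.1 z, fun hz => h.2 z hz.1 hz.2⟩,
    fun h => ⟨fun z => (h z).1, fun z hz hz' => (h z).2 ⟨hz, hz'⟩⟩⟩

theorem Dfn.inter_mem (hf : Tm N f) (hg : Tm N g) (hk : Tm N k) :
    Dfn N (fun v => f v ∩ g v ∈ k v) :=
  (Dfn.bex (φ := fun v x => x = f v ∩ g v) hk
    (Dfn.eq_inter (Tm.var 0) hf.tail hg.tail)).congr
    fun _ => ⟨fun ⟨_, h, e⟩ => e ▸ h, fun h => ⟨_, h, rfl⟩⟩

theorem Dfn.isFilterRO (h0 : Tm N (fun _ => ∅)) (hC : Tm N (fun _ => P.carrier))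
    (hR : Tm N (fun _ => P.RO)) (hf : Tm N f) : Dfn N (fun v => P.IsFilterRO (f v)) := by
  unfold SetPoset.IsFilterRO
  exact Dfn.and (Dfn.subset hf hR) (Dfn.and (Dfn.mem hC hf) (Dfn.and (Dfn.not (Dfn.mem h0 hf))
    (Dfn.and (Dfn.ball hf (Dfn.ball hR.tail (Dfn.imp (Dfn.subset (Tm.var 1) (Tm.var 0))
      (Dfn.mem (Tm.var 0) hf.tail.tail))))
    (Dfn.ball hf (Dfn.ball hf.tail (Dfn.inter_mem (Tm.var 1) (Tm.var 0) hf.tail.tail))))))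

theorem Dfn.isUltra (h0 : Tm N (fun _ => ∅)) (hC : Tm N (fun _ => P.carrier))
    (hR : Tm N (fun _ => P.RO)) (hf : Tm N f) : Dfn N (fun v => P.IsUltra (f v)) := by
  unfold SetPoset.IsUltra
  exact Dfn.and (Dfn.isFilterRO h0 hC hR hf) (Dfn.ball hR (Dfn.imp
    (Dfn.not (Dfn.mem (Tm.var 0) hf.tail)) (Dfn.bex hf.tail
      (Dfn.ball (Tm.var 1) (Dfn.not (Dfn.mem (Tm.var 0) (Tm.var 1)))))))

theorem Dfn.isRegularOpen (hC : Tm N (fun _ => condSet I)) (hf : Tm N f) :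
    Dfn N (fun v => (idealForcing.{u} I).IsRegularOpen (f v)) := by
  simp only [isRegularOpen_iff]
  exact Dfn.and (Dfn.subset hf hC) (Dfn.and
    (Dfn.ball hf (Dfn.ball hC.tail (Dfn.imp (Dfn.subset (Tm.var 0) (Tm.var 1))
      (Dfn.mem (Tm.var 0) hf.tail.tail))))
    (Dfn.ball hC (Dfn.imp
      (Dfn.ball hC.tail (Dfn.imp (Dfn.subset (Tm.var 0) (Tm.var 1))
        (Dfn.bex hf.tail.tail (Dfn.subset (Tm.var 0) (Tm.var 1)))))
      (Dfn.mem (Tm.var 0) hf.tail))))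

/-- The set-theoretic expression of `Captures`. -/
def CapturesZ (C S R x b : ZFSet.{u}) : Prop :=
  ∀ R' ∈ C, R' ⊆ S → TrunkZ C R' x → (∀ v ∈ R', IsSucc x v → v ∈ R) →
    ∃ v ∈ R', IsSucc x v ∧ ∃ G ∈ C, G ⊆ S ∧ G ∈ b ∧ TrunkZ C G v

theorem Dfn.capturesZ (hf : Tm N f) (hg : Tm N g) (hk : Tm N k) (hl : Tm N l) (hm : Tm N m) :
    Dfn N (fun v => CapturesZ (f v) (g v) (k v) (l v) (m v)) := by
  unfold CapturesZ
  exact Dfn.ball hf (Dfn.imp (Dfn.subset (Tm.var 0) hg.tail) (Dfn.imp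
    (Dfn.trunkZ hf.tail (Tm.var 0) hl.tail) (Dfn.imp
    (Dfn.ball (Tm.var 0) (Dfn.imp (Dfn.isSucc hl.tail.tail (Tm.var 0))
      (Dfn.mem (Tm.var 0) hk.tail.tail)))
    (Dfn.bex (Tm.var 0) (Dfn.and (Dfn.isSucc hl.tail.tail (Tm.var 0))
      (Dfn.bex hf.tail.tail (Dfn.and (Dfn.subset (Tm.var 0) hg.tail.tail.tail)
        (Dfn.and (Dfn.mem (Tm.var 0) hm.tail.tail.tail)
          (Dfn.trunkZ hf.tail.tail.tail (Tm.var 0) (Tm.var 1))))))))))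

/-- Distinct members of `F` are paired by `f` with distinct members of `S`. -/
def FunctionalZ (f S F : ZFSet.{u}) : Prop :=
  ∀ s ∈ S, ∀ b ∈ F, ∀ b' ∈ F, ZFSet.pair s b ∈ f → ZFSet.pair s b' ∈ f → b = b'

theorem Dfn.functionalZ (hf : Tm N f) (hg : Tm N g) (hk : Tm N k) :
    Dfn N (fun v => FunctionalZ (f v) (g v) (k v)) := by
  unfold FunctionalZ
  exact Dfn.ball hg (Dfn.ball hk.tail (Dfn.ball hk.tail.tail (Dfn.imp
    (Dfn.pair_mem (Tm.var 2) (Tm.var 1) hf.tail.tail.tail) (Dfn.imp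
    (Dfn.pair_mem (Tm.var 2) (Tm.var 0) hf.tail.tail.tail) (Dfn.eq (Tm.var 1) (Tm.var 0))))))

end Definability

open Descriptive

variable {I : Order.Ideal (Set ℕ)}

theorem capturesZ_iff {S R : tree ℕ} {x : List ℕ} {b : ZFSet.{u}} :
    CapturesZ (condSet I) (treeCode S) (treeCode R) (seqCode x) b ↔ Captures I S R x b := by
  constructor
  · intro h R' hR' ht hsub
    obtain ⟨v, hv, hsucc, G, hG, hGS, hGb, hGt⟩ := h _ (treeCode_mem_condSet.2 ⟨x, ht⟩)
      (treeCode_subset.2 hR') (trunkZ_iff.2 ht) (by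
        intro v hv hsucc
        obtain ⟨v, hvR, rfl⟩ := mem_treeCode.1 hv
        obtain ⟨n, rfl⟩ := isSucc_seqCode.1 hsucc
        exact seqCode_mem_treeCode.2 (hsub n hvR))
    obtain ⟨v, hvR, rfl⟩ := mem_treeCode.1 hv
    obtain ⟨n, rfl⟩ := isSucc_seqCode.1 hsucc
    obtain ⟨G, -, rfl⟩ := mem_condSet.1 hG
    exact ⟨n, hvR, G, treeCode_subset.1 hGS, hGb, trunkZ_iff.1 hGt⟩
  · intro h R' hR' hRS ht hsub
    obtain ⟨R', -, rfl⟩ := mem_condSet.1 hR'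
    obtain ⟨n, hn, G, hGS, hGb, hGt⟩ := h R' (treeCode_subset.1 hRS) (trunkZ_iff.1 ht)
      fun n hn => seqCode_mem_treeCode.1 (hsub _ (seqCode_mem_treeCode.2 hn)
        (isSucc_seqCode.2 ⟨n, rfl⟩))
    exact ⟨_, seqCode_mem_treeCode.2 hn, isSucc_seqCode.2 ⟨n, rfl⟩, treeCode G,
      treeCode_mem_condSet.2 ⟨_, hGt⟩, treeCode_subset.2 hGS, hGb, trunkZ_iff.2 hGt⟩

theorem natCode_lt_omega (n : ℕ) : (natCode.{u} n).rank < Ordinal.omega0 := by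
  rw [natCode, Ordinal.rank_toZFSet]
  exact Ordinal.natCast_lt_omega0 n

theorem rank_pair_lt {o : Ordinal.{u}} (ho : Order.IsSuccLimit o) {x y : ZFSet.{u}}
    (hx : x.rank < o) (hy : y.rank < o) : (ZFSet.pair x y).rank < o := by
  simp only [ZFSet.pair, ZFSet.rank_pair, ZFSet.rank_singleton, max_lt_iff]
  exact ⟨ho.succ_lt (ho.succ_lt hx), ho.succ_lt (max_lt (ho.succ_lt hx) (ho.succ_lt hy))⟩

/-- The sets which belong to the submodel `N`. -/
abbrev setsOf {θ : Cardinal.{u}} (N : setLanguage.ElementarySubstructure (H θ)) :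
    Set ZFSet.{u} :=
  Subtype.val '' (N : Set (H θ))

/-- `N` is an elementary submodel of an `H θ` which contains all sets of small rank over the set of
conditions of `P(I)`, and the poset `P(I)` belongs to `N`. -/
structure IsModelOf {θ : Cardinal.{u}} (N : setLanguage.ElementarySubstructure (H θ))
    (I : Order.Ideal (Set ℕ)) : Prop where
  mem_H : ∀ x : ZFSet.{u}, x.rank < (condSet I).rank + Ordinal.omega0 → x ∈ H θ
  poset_mem : (idealForcing.{u} I).toZFSet ∈ setsOf N

/-! ### Objects found in the submodel by elementarity. -/

namespace IsModelOf

variable {θ : Cardinal.{u}} {N : setLanguage.ElementarySubstructure (H θ)}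

theorem limit (I : Order.Ideal (Set ℕ)) :
    Order.IsSuccLimit ((condSet.{u} I).rank + Ordinal.omega0) :=
  Ordinal.isSuccLimit_add _ Ordinal.isSuccLimit_omega0

theorem mem_H_of_lt_omega (h : IsModelOf N I) {x : ZFSet.{u}} (hx : x.rank < Ordinal.omega0) : x ∈ H θ :=
  h.mem_H x (hx.trans_le le_add_self)

theorem condSet_mem (h : IsModelOf N I) : condSet.{u} I ∈ setsOf N := by
  obtain ⟨z, hz, e, -, r, -, hpair⟩ := exists_mem_of_dfn (N := N)
    (φ := fun z => ∃ e ∈ (idealForcing.{u} I).toZFSet, ∃ r ∈ e,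
      (idealForcing.{u} I).toZFSet = ZFSet.pair z r)
    (Dfn.bex (Tm.par h.poset_mem) (Dfn.bex (Tm.var 0)
      (Dfn.eq_pair (Tm.par h.poset_mem) (Tm.var 2) (Tm.var 0))))
    ⟨condSet I, h.mem_H _ (by simp),
      {condSet I, (idealForcing.{u} I).rel}, by simp [SetPoset.toZFSet, ZFSet.pair],
      (idealForcing.{u} I).rel, by simp, rfl⟩
  have e : condSet.{u} I = z := (ZFSet.pair_inj.1 hpair).1
  rwa [e]

theorem RO_rank (I : Order.Ideal (Set ℕ)) : (idealForcing.{u} I).RO.rank ≤ Order.succ (condSet.{u} I).rank := by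
  rw [← ZFSet.rank_powerset]
  exact ZFSet.rank_mono ZFSet.sep_subset

theorem mem_H_of_subset_RO (h : IsModelOf N I) {x : ZFSet.{u}} (hx : x ⊆ (idealForcing.{u} I).RO) : x ∈ H θ :=
  h.mem_H _ (((ZFSet.rank_mono hx).trans (RO_rank I)).trans_lt
    ((limit I).succ_lt (by simp)))

/-- Regular openness is definable from the set of conditions, and all regular open sets lie in `H
θ`; extensionality then identifies the witness. -/
theorem RO_mem (h : IsModelOf N I) : (idealForcing.{u} I).RO ∈ setsOf N := by
  have hRO := h.mem_H_of_subset_RO (x := (idealForcing.{u} I).RO) fun _ hz => hz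
  obtain ⟨z, hz, hz'⟩ := exists_mem_of_dfn (N := N)
    (φ := fun z => ∀ b : H θ, (b : ZFSet.{u}) ∈ z ↔ (idealForcing.{u} I).IsRegularOpen b)
    (Dfn.all (Dfn.iff (Dfn.mem (Tm.var 0) (Tm.var 1))
      (Dfn.isRegularOpen (Tm.par h.condSet_mem) (Tm.var 0))))
    ⟨_, hRO, fun b => SetPoset.mem_RO⟩
  have hzH : z ∈ H θ := by
    obtain ⟨w, -, rfl⟩ := hz
    exact w.2
  have : z = (idealForcing.{u} I).RO := by
    ext b
    constructor
    · intro hb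
      exact SetPoset.mem_RO.2 ((hz' ⟨b, H_transitive hzH hb⟩).1 hb)
    · intro hb
      exact (hz' ⟨b, H_transitive hRO hb⟩).2 (SetPoset.mem_RO.1 hb)
  exact this ▸ hz

theorem empty_mem (h : IsModelOf N I) : (∅ : ZFSet.{u}) ∈ setsOf N := by
  obtain ⟨z, hz, hz'⟩ := exists_mem_of_dfn (N := N) (φ := fun z => ∀ y ∈ z, y ≠ y)
    (Dfn.ball (Tm.var 0) (Dfn.not (Dfn.eq (Tm.var 0) (Tm.var 0))))
    ⟨∅, h.mem_H_of_lt_omega (by simp),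
      fun y hy => (ZFSet.notMem_empty y hy).elim⟩
  have : z = ∅ := (ZFSet.eq_empty z).2 fun y hy => hz' y hy rfl
  exact this ▸ hz

theorem insert_mem {a b : ZFSet.{u}} (ha : a ∈ setsOf N) (hb : b ∈ setsOf N) (hab : insert a b ∈ H θ) :
    insert a b ∈ setsOf N := by
  obtain ⟨z, hz, rfl⟩ := exists_mem_of_dfn (N := N) (φ := fun z => z = insert a b)
    (Dfn.eq_insert (Tm.var 0) (Tm.par ha) (Tm.par hb)) ⟨_, hab, rfl⟩
  exact hz

theorem pair_mem {a b : ZFSet.{u}} (ha : a ∈ setsOf N) (hb : b ∈ setsOf N) (hab : ZFSet.pair a b ∈ H θ) :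
    ZFSet.pair a b ∈ setsOf N := by
  obtain ⟨z, hz, rfl⟩ := exists_mem_of_dfn (N := N) (φ := fun z => z = ZFSet.pair a b)
    (Dfn.eq_pair (Tm.var 0) (Tm.par ha) (Tm.par hb)) ⟨_, hab, rfl⟩
  exact hz

theorem natCode_mem (h : IsModelOf N I) (n : ℕ) : natCode.{u} n ∈ setsOf N := by
  induction n with
  | zero => simpa [natCode] using h.empty_mem
  | succ n ih =>
    have e : natCode.{u} (n + 1) = insert (natCode n) (natCode n) := by
      simp only [natCode, Nat.cast_add, Nat.cast_one, Ordinal.toZFSet_add_one]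
    rw [e]
    exact insert_mem ih ih (e ▸ h.mem_H_of_lt_omega (natCode_lt_omega _))

theorem seqCode_mem (h : IsModelOf N I) (s : List ℕ) : seqCode.{u} s ∈ setsOf N := by
  have hrank : ∀ i n : ℕ, (ZFSet.pair (natCode.{u} i) (natCode n)).rank < Ordinal.omega0 :=
    fun i n => rank_pair_lt Ordinal.isSuccLimit_omega0 (natCode_lt_omega i) (natCode_lt_omega n)
  have : (seqCode.{u} s).rank < Ordinal.omega0 ∧ seqCode.{u} s ∈ setsOf N := by
    induction s using List.reverseRecOn with
    | nil =>
      rw [seqCode_nil]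
      exact ⟨by simp, h.empty_mem⟩
    | append_singleton s n ih =>
      have hr : (seqCode.{u} (s ++ [n])).rank < Ordinal.omega0 := by
        rw [seqCode_concat, ZFSet.rank_insert]
        exact max_lt (Ordinal.isSuccLimit_omega0.succ_lt (hrank _ _)) ih.1
      refine ⟨hr, ?_⟩
      have hH := h.mem_H_of_lt_omega hr
      rw [seqCode_concat] at hH ⊢
      exact insert_mem (pair_mem (h.natCode_mem _) (h.natCode_mem _)
        (h.mem_H_of_lt_omega (hrank _ _))) ih.2 hH
  exact this.2

theorem mem_H_of_mem_condSet (h : IsModelOf N I) {p : ZFSet.{u}} (hp : p ∈ condSet.{u} I) : p ∈ H θ := by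
  obtain ⟨w, -, hw⟩ := h.condSet_mem
  exact H_transitive (hw ▸ w.2) hp

theorem exists_tree_mem (h : IsModelOf N I) {b : ZFSet.{u}} (hb : b ∈ setsOf N) {S : tree ℕ} (hS : treeCode S ∈ setsOf N)
    {x : List ℕ} (hex : ∃ G ≤ S, treeCode G ∈ b ∧ Trunk I G x) :
    ∃ G ≤ S, treeCode G ∈ setsOf N ∧ treeCode G ∈ b ∧ Trunk I G x := by
  obtain ⟨G, hGS, hGb, hGt⟩ := hex
  have hGC : treeCode.{u} G ∈ condSet I := treeCode_mem_condSet.2 ⟨x, hGt⟩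
  obtain ⟨z, hz, hzC, hzS, hzb, hzt⟩ := exists_mem_of_dfn (N := N)
    (φ := fun z => z ∈ condSet I ∧ z ⊆ treeCode S ∧ z ∈ b ∧ TrunkZ (condSet I) z (seqCode x))
    (Dfn.and (Dfn.mem (Tm.var 0) (Tm.par h.condSet_mem)) (Dfn.and
      (Dfn.subset (Tm.var 0) (Tm.par hS)) (Dfn.and (Dfn.mem (Tm.var 0) (Tm.par hb))
        (Dfn.trunkZ (Tm.par h.condSet_mem) (Tm.var 0) (Tm.par (h.seqCode_mem x))))))
    ⟨_, h.mem_H_of_mem_condSet hGC, hGC, treeCode_subset.2 hGS, hGb, trunkZ_iff.2 hGt⟩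
  obtain ⟨G', -, rfl⟩ := mem_condSet.1 hzC
  exact ⟨G', treeCode_subset.1 hzS, hz, hzb, trunkZ_iff.1 hzt⟩

theorem exists_tree_mem_below (h : IsModelOf N I) {D : ZFSet.{u}} (hD : D ∈ setsOf N) (hDC : D ⊆ condSet I) {S : tree ℕ}
    (hS : treeCode S ∈ setsOf N) {x : List ℕ}
    (hex : ∃ G ≤ S, Trunk I G x ∧ ∃ d ∈ D, treeCode G ⊆ d) :
    ∃ G ≤ S, treeCode G ∈ setsOf N ∧ Trunk I G x ∧ ∃ d ∈ D, d ∈ setsOf N ∧ treeCode G ⊆ d := by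
  obtain ⟨G, hGS, hGt, hGD⟩ := hex
  have hGC : treeCode.{u} G ∈ condSet I := treeCode_mem_condSet.2 ⟨x, hGt⟩
  obtain ⟨z, hz, hzC, hzS, hzt, hzD⟩ := exists_mem_of_dfn (N := N)
    (φ := fun z => z ∈ condSet I ∧ z ⊆ treeCode S ∧ TrunkZ (condSet I) z (seqCode x) ∧
      ∃ d ∈ D, z ⊆ d)
    (Dfn.and (Dfn.mem (Tm.var 0) (Tm.par h.condSet_mem)) (Dfn.and
      (Dfn.subset (Tm.var 0) (Tm.par hS)) (Dfn.and
        (Dfn.trunkZ (Tm.par h.condSet_mem) (Tm.var 0) (Tm.par (h.seqCode_mem x)))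
        (Dfn.bex (Tm.par hD) (Dfn.subset (Tm.var 1) (Tm.var 0))))))
    ⟨_, h.mem_H_of_mem_condSet hGC, hGC, treeCode_subset.2 hGS, trunkZ_iff.2 hGt, hGD⟩
  obtain ⟨d, hdD, hzd⟩ := hzD
  obtain ⟨d', hd', hd'D, hzd'⟩ := exists_mem_of_dfn (N := N) (φ := fun d => d ∈ D ∧ z ⊆ d)
    (Dfn.and (Dfn.mem (Tm.var 0) (Tm.par hD)) (Dfn.subset (Tm.par hz) (Tm.var 0)))
    ⟨d, h.mem_H_of_mem_condSet (hDC hdD), hdD, hzd⟩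
  obtain ⟨G', -, rfl⟩ := mem_condSet.1 hzC
  exact ⟨G', treeCode_subset.1 hzS, hz, trunkZ_iff.1 hzt, d', hd'D, hd', hzd'⟩

theorem inter_mem (h : IsModelOf N I) {F a b : ZFSet.{u}} (hF : (idealForcing.{u} I).IsFilterRO F)
    (ha : a ∈ setsOf N) (hb : b ∈ setsOf N) (haF : a ∈ F) (hbF : b ∈ F) : a ∩ b ∈ setsOf N := by
  obtain ⟨z, hz, rfl⟩ := exists_mem_of_dfn (N := N) (φ := fun z => z = a ∩ b)
    (Dfn.eq_inter (Tm.var 0) (Tm.par ha) (Tm.par hb))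
    ⟨_, H_transitive (h.mem_H_of_subset_RO hF.1) (hF.2.2.2.2 a haF b hbF), rfl⟩
  exact hz

theorem exists_disjoint_mem (h : IsModelOf N I) {F b : ZFSet.{u}} (hF : (idealForcing.{u} I).IsUltra F) (hFM : F ∈ setsOf N)
    (hb : b ∈ setsOf N) (hbRO : b ∈ (idealForcing.{u} I).RO) (hbF : b ∉ F) :
    ∃ b' ∈ setsOf N, b' ∈ F ∧ ∀ z ∈ b, z ∉ b' := by
  obtain ⟨b', hb', hdisj⟩ := hF.2 b hbRO hbF
  exact exists_mem_of_dfn (N := N) (φ := fun b' => b' ∈ F ∧ ∀ z ∈ b, z ∉ b')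
    (Dfn.and (Dfn.mem (Tm.var 0) (Tm.par hFM)) (Dfn.ball (Tm.par hb)
      (Dfn.not (Dfn.mem (Tm.var 0) (Tm.var 1)))))
    ⟨b', H_transitive (h.mem_H_of_subset_RO hF.1.1) hb', hb', hdisj⟩

/-- The set `F ∩ N` is countable but need not belong to the submodel. The formula therefore asserts
capturing for every countable subfamily of `F`, indexed by a partial function `f` on the countable
set of nodes of `S`; once `F` is found in the submodel, an external `f` in `H θ` enumerating `F ∩ N`
is plugged in. -/
theorem exists_ultra_mem (h : IsModelOf N I) (hI : IsIntersectionOfFSigmaIdeals I) (hN : (setsOf N).Countable) {S : tree ℕ}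
    (hS : treeCode S ∈ setsOf N) {x : List ℕ} (ht : Trunk I S x)
    (hpos : {n | x ++ [n] ∈ S ∧ {n} ∈ I} ∉ I) :
    ∃ F ∈ setsOf N, (idealForcing.{u} I).IsUltra F ∧
      ∃ R ≤ S, Trunk I R x ∧ ∀ b ∈ F, b ∈ setsOf N → Captures I S R x b := by
  have hC := Tm.par h.condSet_mem
  obtain ⟨F, hFM, hFU, hF⟩ := exists_mem_of_dfn (N := N)
    (φ := fun F => (idealForcing.{u} I).IsUltra F ∧ ∀ f : H θ,
      FunctionalZ f (treeCode S) F → ∃ R ∈ condSet I, R ⊆ treeCode S ∧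
        TrunkZ (condSet I) R (seqCode x) ∧ ∀ b ∈ F, (∃ s ∈ treeCode S, ZFSet.pair s b ∈
          (f : ZFSet.{u})) → CapturesZ (condSet I) (treeCode S) R (seqCode x) b)
    (Dfn.and (Dfn.isUltra (Tm.par h.empty_mem) hC (Tm.par h.RO_mem) (Tm.var 0))
      (Dfn.all (Dfn.imp (Dfn.functionalZ (Tm.var 0) (Tm.par hS) (Tm.var 1))
        (Dfn.bex hC (Dfn.and (Dfn.subset (Tm.var 0) (Tm.par hS)) (Dfn.and
          (Dfn.trunkZ hC (Tm.var 0) (Tm.par (h.seqCode_mem x)))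
          (Dfn.ball (Tm.var 2) (Dfn.imp
            (Dfn.bex (Tm.par hS) (Dfn.pair_mem (Tm.var 0) (Tm.var 1) (Tm.var 3)))
            (Dfn.capturesZ hC (Tm.par hS) (Tm.var 1) (Tm.par (h.seqCode_mem x))
              (Tm.var 0))))))))))
    (by
      obtain ⟨F, hFU, hF⟩ := exists_ultra_captures.{u} hI ht hpos
      refine ⟨F, h.mem_H_of_subset_RO hFU.1.1, hFU, fun f hf => ?_⟩
      obtain ⟨R, hRS, hRt, hR⟩ := hF
        {b | b ∈ F ∧ ∃ s ∈ treeCode S, ZFSet.pair s b ∈ (f : ZFSet.{u})} (by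
          refine (Set.countable_iUnion fun s : S => (Set.Subsingleton.countable
            (s := {b | b ∈ F ∧ ZFSet.pair (seqCode s.1) b ∈ (f : ZFSet.{u})}) ?_)).mono ?_
          · rintro b ⟨hb, hbf⟩ b' ⟨hb', hbf'⟩
            exact hf _ (seqCode_mem_treeCode.2 s.2) b hb b' hb' hbf hbf'
          · rintro b ⟨hb, s, hs, hsf⟩
            obtain ⟨s, hsS, rfl⟩ := mem_treeCode.1 hs
            exact Set.mem_iUnion.2 ⟨⟨s, hsS⟩, hb, hsf⟩) fun b hb => hb.1
      exact ⟨treeCode R, treeCode_mem_condSet.2 ⟨x, hRt⟩, treeCode_subset.2 hRS,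
        trunkZ_iff.2 hRt, fun b hb hbf => capturesZ_iff.2 (hR b ⟨hb, hbf⟩)⟩)
  refine ⟨F, hFM, hFU, ?_⟩
  obtain ⟨e, he⟩ := (hN.mono (Set.inter_subset_left (t := {b | b ∈ F}))).exists_eq_range
    ⟨condSet I, h.condSet_mem, hFU.1.2.1⟩
  -- Nodes of different lengths are distinct, so they can index an enumeration.
  have hnode : ∀ k : ℕ, ∃ s ∈ S, s.length = k := by
    intro k
    obtain ⟨s, hs, -, hk⟩ := ht.exists_long k
    exact ⟨s.take k, Tree.mem_of_prefix (List.take_prefix _ _) hs, by simpa using hk⟩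
  choose s hsS hslen using hnode
  let f : ZFSet.{u} := ZFSet.range fun k : ℕ => ZFSet.pair (seqCode (s k)) (e k)
  have heF : ∀ k, e k ∈ F := fun k => (he ▸ Set.mem_range_self k : e k ∈ setsOf N ∩ {b | b ∈ F}).2
  have hf : f ∈ H θ := by
    refine h.mem_H _ (lt_of_le_of_lt (b := Order.succ (Order.succ (Order.succ (condSet I).rank)))
      (ZFSet.rank_le_iff.2 fun y hy => ?_) ((limit I).succ_lt ((limit I).succ_lt
        ((limit I).succ_lt (by simp)))))
    obtain ⟨k, rfl⟩ := ZFSet.mem_range.1 hy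
    have h1 : (seqCode.{u} (s k)).rank < (condSet I).rank :=
      (ZFSet.rank_lt_of_mem (seqCode_mem_treeCode.2 (hsS k))).trans
        (ZFSet.rank_lt_of_mem (treeCode_mem_condSet.2 ⟨x, ht⟩))
    have h2 : (e k).rank ≤ (condSet.{u} I).rank :=
      ZFSet.rank_mono (SetPoset.mem_RO.1 (hFU.1.1 (heF k))).1
    simp only [ZFSet.pair, ZFSet.rank_pair, ZFSet.rank_singleton, Order.lt_succ_iff]
    refine max_le (Order.succ_le_succ ?_) (Order.succ_le_succ (max_le ?_ ?_))
    · exact (Order.succ_le_of_lt h1).trans (Order.le_succ _)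
    · exact (Order.succ_le_of_lt h1).trans (Order.le_succ _)
    · exact Order.succ_le_succ h2
  have hfun : FunctionalZ f (treeCode S) F := by
    intro t _ b _ b' _ hbf hbf'
    obtain ⟨k, hk⟩ := ZFSet.mem_range.1 hbf
    obtain ⟨j, hj⟩ := ZFSet.mem_range.1 hbf'
    obtain ⟨rfl, rfl⟩ := ZFSet.pair_inj.1 hk
    obtain ⟨hjs, rfl⟩ := ZFSet.pair_inj.1 hj
    have hjk := seqCode_injective hjs
    rw [← hslen k, ← hjk, hslen j]
  obtain ⟨R, hRC, hRS, hRt, hR⟩ := hF ⟨f, hf⟩ hfun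
  obtain ⟨R, -, rfl⟩ := mem_condSet.1 hRC
  refine ⟨R, treeCode_subset.1 hRS, trunkZ_iff.1 hRt, fun b hb hbM => ?_⟩
  obtain ⟨k, rfl⟩ : b ∈ Set.range e := he ▸ ⟨hbM, hb⟩
  exact capturesZ_iff.1 (hR _ hb ⟨_, seqCode_mem_treeCode.2 (hsS k),
    ZFSet.mem_range.2 ⟨k, rfl⟩⟩)

end IsModelOf

end YProperness

namespace YProperness

open Descriptive

variable {I : Order.Ideal (Set ℕ)}

theorem SetPoset.mem_embed_self {P : SetPoset.{u}} {p : ZFSet.{u}} (hp : p ∈ P.carrier) :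
    p ∈ P.embed p :=
  ZFSet.mem_sep.2 ⟨hp, fun y hy hyp => ⟨y, hy, P.refl y hy, hyp⟩⟩

/-! ### Construction of Y-master conditions. -/

namespace IsModelOf

variable {θ : Cardinal.{u}} {N : setLanguage.ElementarySubstructure (H θ)}

/-- If `T` has an extension with trunk `s` below a member of one of the sets `D 0, ..., D (k - 1)`,
then `T` itself is below a member of that set which belongs to `N`. -/
def Meets (N : setLanguage.ElementarySubstructure (H θ)) (I : Order.Ideal (Set ℕ))
    (D : ℕ → ZFSet.{u}) (T : tree ℕ) (s : List ℕ) (k : ℕ) : Prop :=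
  ∀ j < k, (∃ G ≤ T, Trunk I G s ∧ ∃ d ∈ D j, treeCode G ⊆ d) →
    ∃ d ∈ D j, d ∈ setsOf N ∧ treeCode T ⊆ d

/-- Finitely many dense sets are treated one after another, each by elementarity; shrinking the tree
preserves what was achieved for the earlier ones. -/
theorem exists_meets (h : IsModelOf N I) {D : ℕ → ZFSet.{u}}
    (hD : ∀ k, D k ∈ setsOf N ∧ D k ⊆ condSet I) {S : tree ℕ} {s : List ℕ}
    (hS : treeCode S ∈ setsOf N) (ht : Trunk I S s) (k : ℕ) :
    ∃ T ≤ S, treeCode T ∈ setsOf N ∧ Trunk I T s ∧ Meets N I D T s k := by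
  induction k with
  | zero => exact ⟨S, le_rfl, hS, ht, fun j hj => absurd hj (Nat.not_lt_zero j)⟩
  | succ k ih =>
    obtain ⟨T, hTS, hT, hTt, hTD⟩ := ih
    by_cases hex : ∃ G ≤ T, Trunk I G s ∧ ∃ d ∈ D k, treeCode G ⊆ d
    · obtain ⟨G, hGT, hG, hGt, hGD⟩ := h.exists_tree_mem_below (hD k).1 (hD k).2 hT hex
      refine ⟨G, hGT.trans hTS, hG, hGt, fun j hj hexj => ?_⟩
      rcases Nat.lt_succ_iff_lt_or_eq.1 hj with hj | rfl
      · obtain ⟨G', hG', hG't, hd⟩ := hexj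
        obtain ⟨d, hd, hdN, hTd⟩ := hTD j hj ⟨G', hG'.trans hGT, hG't, hd⟩
        exact ⟨d, hd, hdN, fun z hz => hTd (treeCode_subset.2 hGT hz)⟩
      · exact hGD
    · refine ⟨T, hTS, hT, hTt, fun j hj hexj => ?_⟩
      rcases Nat.lt_succ_iff_lt_or_eq.1 hj with hj | rfl
      · exact hTD j hj hexj
      · exact absurd hexj hex

/-- One step of the fusion, at a node all of whose relevant successors are negligible: the trees
assigned to the successors meet the members of an ultrafilter in the submodel. -/
def StepUltra (N : setLanguage.ElementarySubstructure (H θ)) (I : Order.Ideal (Set ℕ))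
    (S : tree ℕ) (x : List ℕ) (Y : Set ℕ) (G : ℕ → tree ℕ) : Prop :=
  {n | x ++ [n] ∈ S ∧ {n} ∈ I} ∉ I → ∃ F ∈ setsOf N, (idealForcing.{u} I).IsUltra F ∧
    ∀ b ∈ F, b ∈ setsOf N → ∀ R ≤ S, Trunk I R x →
      (∀ n, x ++ [n] ∈ R → n ∈ Y ∧ {n} ∈ I) → ∃ n, x ++ [n] ∈ R ∧ treeCode (G n) ∈ b

/-- Each `G n` is chosen in the submodel, but the sequence is not: it follows an external
enumeration of `F ∩ N`, with `G n` put into the smallest available one of the first `n + 1` finite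
intersections. -/
theorem exists_stepUltra (h : IsModelOf N I) (hI : IsIntersectionOfFSigmaIdeals I)
    (hN : (setsOf N).Countable) {S : tree ℕ} {x : List ℕ} (hS : treeCode S ∈ setsOf N)
    (ht : Trunk I S x) :
    ∃ Y, Y ∉ I ∧ ∃ G : ℕ → tree ℕ, (∀ n ∈ Y, G n ≤ S ∧ treeCode (G n) ∈ setsOf N ∧
      Trunk I (G n) (x ++ [n])) ∧ StepUltra N I S x Y G := by
  have hbase : ∀ n, x ++ [n] ∈ S →
      ∃ G ≤ S, treeCode G ∈ setsOf N ∧ Trunk I G (x ++ [n]) := by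
    intro n hn
    have htn := trunk_restrict ht hn (List.prefix_append _ _)
    obtain ⟨G, h1, h2, -, h3⟩ := h.exists_tree_mem h.condSet_mem hS
      ⟨_, restrict_le S (x ++ [n]), treeCode_mem_condSet.2 ⟨_, htn⟩, htn⟩
    exact ⟨G, h1, h2, h3⟩
  by_cases hpos : {n | x ++ [n] ∈ S ∧ {n} ∈ I} ∈ I
  · choose! G hG using hbase
    exact ⟨{n | x ++ [n] ∈ S}, ht.2.2 x ht.1 List.prefix_rfl, G, hG, fun h' => absurd hpos h'⟩
  obtain ⟨F, hFN, hFU, R, hRS, hRt, hR⟩ := h.exists_ultra_mem hI hN hS ht hpos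
  obtain ⟨e, he⟩ := (hN.mono (Set.inter_subset_left (t := {b | b ∈ F}))).exists_eq_range
    ⟨condSet I, h.condSet_mem, hFU.1.2.1⟩
  have heF : ∀ k, e k ∈ setsOf N ∩ {b | b ∈ F} := fun k => he ▸ Set.mem_range_self k
  let d : ℕ → ZFSet.{u} := fun k => Nat.rec (e 0) (fun k a => a ∩ e (k + 1)) k
  have hdF : ∀ k, d k ∈ setsOf N ∧ d k ∈ F := by
    intro k
    induction k with
    | zero => exact heF 0
    | succ k ih =>
      exact ⟨inter_mem h hFU.1 ih.1 (heF (k + 1)).1 ih.2 (heF (k + 1)).2,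
        hFU.1.2.2.2.2 _ ih.2 _ (heF (k + 1)).2⟩
  have hde : ∀ k, d k ⊆ e k := by
    intro k
    cases k with
    | zero => exact fun _ h => h
    | succ k => exact fun z hz => (ZFSet.mem_inter.1 hz).2
  have hanti : ∀ j k, j ≤ k → d k ⊆ d j := by
    intro j k hjk
    induction k, hjk using Nat.le_induction with
    | base => exact fun _ hz => hz
    | succ k _ ih => exact fun z hz => ih (ZFSet.mem_inter.1 hz).1
  have hchoice : ∀ n, x ++ [n] ∈ R → ∀ m, ∃ G ≤ S, treeCode G ∈ setsOf N ∧
      Trunk I G (x ++ [n]) ∧ ∀ j ≤ m,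
        (∃ G' ≤ S, treeCode G' ∈ d j ∧ Trunk I G' (x ++ [n])) → treeCode G ∈ d j := by
    intro n hn m
    have hcase : ∀ m, (∃ G' ≤ S, treeCode G' ∈ d m ∧ Trunk I G' (x ++ [n])) →
        ∃ G ≤ S, treeCode G ∈ setsOf N ∧ Trunk I G (x ++ [n]) ∧ ∀ j ≤ m,
          (∃ G' ≤ S, treeCode G' ∈ d j ∧ Trunk I G' (x ++ [n])) → treeCode G ∈ d j := by
      intro m hex
      obtain ⟨G, h1, h2, h3, h4⟩ := h.exists_tree_mem (hdF m).1 hS hex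
      exact ⟨G, h1, h2, h4, fun j hj _ => hanti j m hj h3⟩
    induction m with
    | zero =>
      by_cases hex : ∃ G' ≤ S, treeCode G' ∈ d 0 ∧ Trunk I G' (x ++ [n])
      · exact hcase 0 hex
      · obtain ⟨G, h1, h2, h3⟩ := hbase n (hRS hn)
        exact ⟨G, h1, h2, h3, fun j hj hexj => absurd (Nat.le_zero.1 hj ▸ hexj) hex⟩
    | succ m ih =>
      by_cases hex : ∃ G' ≤ S, treeCode G' ∈ d (m + 1) ∧ Trunk I G' (x ++ [n])
      · exact hcase _ hex
      · obtain ⟨G, h1, h2, h3, h4⟩ := ih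
        refine ⟨G, h1, h2, h3, fun j hj hexj => ?_⟩
        rcases Nat.le_succ_iff.1 hj with hj | rfl
        · exact h4 j hj hexj
        · exact absurd hexj hex
  choose! G hG1 hG2 hG3 hG4 using fun n (hn : x ++ [n] ∈ R) => hchoice n hn n
  refine ⟨{n | x ++ [n] ∈ R}, hRt.2.2 x hRt.1 List.prefix_rfl, G,
    fun n hn => ⟨hG1 n hn, hG2 n hn, hG3 n hn⟩, fun _ => ⟨F, hFN, hFU, ?_⟩⟩
  intro b hb hbN R' hR'S hR't hR'Y
  obtain ⟨m, rfl⟩ : b ∈ Set.range e := he ▸ ⟨hbN, hb⟩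
  -- The choice of `G n` takes `d m` into account only for `m ≤ n`. The finitely many smaller
  -- successors have singletons in `I` and can be dropped.
  have hc : {n | x ++ [n] ∈ R' ∧ m ≤ n} ∉ I := by
    intro hc
    refine hR't.2.2 x hR't.1 List.prefix_rfl (I.lower ?_ (union_mem_ideal hc
      (finite_mem_ideal (a := {n | x ++ [n] ∈ R' ∧ n < m})
        ((Set.finite_lt_nat m).subset fun n hn => hn.2) fun n hn => (hR'Y n hn.1).2)))
    intro n hn
    exact (le_or_gt m n).imp (fun h => ⟨hn, h⟩) fun h => ⟨hn, h⟩
  obtain ⟨R'', hR'', hR''t, hR''c⟩ := hR't.exists_prune hc fun n hn => hn.1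
  obtain ⟨n, hn, G', hG'S, hG'd, hG't⟩ := hR _ (hdF m).2 (hdF m).1 R'' (hR''.trans hR'S) hR''t
    fun n hn => (hR'Y n (hR'' hn)).1
  exact ⟨n, hR'' hn, hde m (hG4 n (hR'Y n (hR'' hn)).1 m (hR''c n hn).2 ⟨G', hG'S, hG'd, hG't⟩)⟩

theorem exists_step (h : IsModelOf N I) (hI : IsIntersectionOfFSigmaIdeals I)
    (hN : (setsOf N).Countable) {D : ℕ → ZFSet.{u}}
    (hD : ∀ k, D k ∈ setsOf N ∧ D k ⊆ condSet I) {S : tree ℕ} {x : List ℕ}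
    (hS : treeCode S ∈ setsOf N) (ht : Trunk I S x) :
    ∃ (Y : Set ℕ) (G : ℕ → tree ℕ), Y ∉ I ∧ (∀ n ∈ Y, G n ≤ S ∧ treeCode (G n) ∈ setsOf N ∧
      Trunk I (G n) (x ++ [n]) ∧ Meets N I D (G n) (x ++ [n]) (x ++ [n]).length) ∧
      StepUltra N I S x Y G := by
  obtain ⟨Y, hY, G, hG, hU⟩ := h.exists_stepUltra hI hN hS ht
  choose! T hT1 hT2 hT3 hT4 using fun n (hn : n ∈ Y) =>
    h.exists_meets hD (hG n hn).2.1 (hG n hn).2.2 (x ++ [n]).length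
  refine ⟨Y, T, hY, fun n hn => ⟨(hT1 n hn).trans (hG n hn).1, hT2 n hn, hT3 n hn, hT4 n hn⟩,
    fun hpos => ?_⟩
  obtain ⟨F, hFN, hFU, hF⟩ := hU hpos
  refine ⟨F, hFN, hFU, fun b hb hbN R hRS hRt hRY => ?_⟩
  obtain ⟨n, hn, hGb⟩ := hF b hb hbN R hRS hRt hRY
  have hnY := (hRY n hn).1
  exact ⟨n, hn, RO_down (hFU.1.1 hb) hGb (hT1 n hnY) ⟨_, hT3 n hnY⟩⟩

/-- Every dense set contains a minimal `U`, and the regular open sets having `U` as a member form an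
ultrafilter definable from `U`. -/
theorem isYMaster_of_minimal (h : IsModelOf N I) {U : ZFSet.{u}} (hU : U ∈ setsOf N)
    (hUC : U ∈ condSet I) (hmin : ∀ V ∈ condSet I, V ⊆ U → V = U) :
    (idealForcing.{u} I).IsYMaster (setsOf N) U := by
  refine ⟨fun D _ hDd r hr hrU => ?_, fun r hr hrU => ?_⟩
  · obtain ⟨d, hd, hdU⟩ := hDd.2 U hUC
    obtain rfl := hmin d (hDd.1 hd) (idealForcing_le.1 hdU).2.2
    exact ⟨d, hd, hU, r, hr, hrU, (idealForcing I).refl r hr⟩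
  · obtain rfl := hmin r hr (idealForcing_le.1 hrU).2.2
    obtain ⟨F, hF, hFRO, hFU⟩ := exists_mem_of_dfn (N := N)
      (φ := fun F => F ⊆ (idealForcing.{u} I).RO ∧
        ∀ b ∈ (idealForcing.{u} I).RO, b ∈ F ↔ r ∈ b)
      (Dfn.and (Dfn.subset (Tm.var 0) (Tm.par h.RO_mem)) (Dfn.ball (Tm.par h.RO_mem)
        (Dfn.iff (Dfn.mem (Tm.var 0) (Tm.var 1)) (Dfn.mem (Tm.par hU) (Tm.var 0)))))
      ⟨ZFSet.sep (r ∈ ·) (idealForcing.{u} I).RO, h.mem_H_of_subset_RO ZFSet.sep_subset,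
        ZFSet.sep_subset, fun b hb => ZFSet.mem_sep.trans (and_iff_right hb)⟩
    refine ⟨F, hF, ⟨hFRO, (hFU _ SetPoset.carrier_mem_RO).2 hUC, fun h0 =>
      ZFSet.notMem_empty _ ((hFU _ (hFRO h0)).1 h0), fun a ha b hb hab => ?_,
      fun a ha b hb => ?_⟩, fun s hs _ hrs => (hFU s hs).2 (hrs (SetPoset.mem_embed_self hr))⟩
    · exact (hFU b hb).2 (hab ((hFU a (hFRO ha)).1 ha))
    · exact (hFU _ (SetPoset.inter_mem_RO (hFRO ha) (hFRO hb))).2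
        (ZFSet.mem_inter.2 ⟨(hFU a (hFRO ha)).1 ha, (hFU b (hFRO hb)).1 hb⟩)

theorem exists_isYMaster_of_no_minimal (h : IsModelOf N I)
    (hI : IsIntersectionOfFSigmaIdeals I) (hN : (setsOf N).Countable) {S : tree ℕ} {x : List ℕ}
    (hS : treeCode S ∈ setsOf N) (ht : Trunk I S x)
    (hmin : ¬ ∃ U ∈ condSet.{u} I, U ⊆ treeCode S ∧ ∀ V ∈ condSet I, V ⊆ U → V = U) :
    ∃ q ≤ S, Cond I q ∧ (idealForcing.{u} I).IsYMaster (setsOf N) (treeCode q) := by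
  have hdense : (idealForcing.{u} I).IsDense (condSet I) :=
    ⟨fun _ hz => hz, fun p hp => ⟨p, hp, (idealForcing I).refl p hp⟩⟩
  obtain ⟨D, hDrange⟩ := (hN.mono (Set.inter_subset_left
    (t := {D | (idealForcing.{u} I).IsDense D}))).exists_eq_range ⟨_, h.condSet_mem, hdense⟩
  have hD : ∀ k, D k ∈ setsOf N ∧ D k ⊆ condSet I := fun k => by
    have : D k ∈ setsOf N ∩ {D | (idealForcing.{u} I).IsDense D} :=
      hDrange ▸ Set.mem_range_self k
    exact ⟨this.1, this.2.1⟩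
  let Good : tree ℕ → List ℕ → Prop := fun T s =>
    treeCode T ∈ setsOf N ∧ Trunk I T s ∧ Meets N I D T s s.length
  have hstep : ∀ T s, Good T s → ∃ (Y : Set ℕ) (G : ℕ → tree ℕ), Y ∉ I ∧
      (∀ n ∈ Y, G n ≤ T ∧ treeCode (G n) ∈ setsOf N ∧ Trunk I (G n) (s ++ [n]) ∧
        Meets N I D (G n) (s ++ [n]) (s ++ [n]).length) ∧ StepUltra N I T s Y G :=
    fun T s hT => h.exists_step hI hN hD hT.1 hT.2.1
  choose! Y nx hY hnx hU using hstep
  obtain ⟨S', hS'S, hS', hS't, hS'D⟩ := h.exists_meets hD hS ht x.length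
  obtain ⟨q, hqS', hqt, hq⟩ := exists_fusion (I := I) (Y := Y) (nx := nx) (S := S') (x := x) Good
    (fun T s hT => ⟨hT.2.1, hY T s hT, fun n hn =>
      ⟨(hnx T s hT n hn).2, (hnx T s hT n hn).1⟩⟩) ⟨hS', hS't, hS'D⟩
  refine ⟨q, hqS'.trans hS'S, ⟨x, hqt⟩, fun E hE hEd r hr hrq => ?_, fun r hr hrq => ?_⟩
  · obtain ⟨k, rfl⟩ : E ∈ Set.range D := hDrange ▸ ⟨hE, hEd⟩
    obtain ⟨r, ⟨t, hrt⟩, rfl⟩ := mem_condSet.1 hr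
    have hrq := treeCode_subset.1 (idealForcing_le.1 hrq).2.2
    obtain ⟨t', ht', hxt'⟩ := hrt.exists_extension fun s hs => hqt.2.1 s (hrq hs)
    -- The tree at a node of length `l` takes care of `D 0, ..., D (l - 1)`, so length `k + 1` is
    -- needed for `D k`.
    obtain ⟨s, hs, hts, hlen⟩ := ht'.exists_long (k + 1)
    obtain ⟨d, hd, hdr⟩ := hEd.2 _ (treeCode_mem_condSet.2 ⟨s, trunk_restrict ht' hs hts⟩)
    obtain ⟨d₀, ⟨w, hw⟩, rfl⟩ := mem_condSet.1 (hEd.1 hd)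
    have hdr := treeCode_subset.1 (idealForcing_le.1 hdr).2.2
    obtain ⟨z, hz, hsz⟩ := hw.exists_extension fun u hu => (hdr hu).2
    have hdr₀ : d₀ ≤ r := hdr.trans (restrict_le _ _)
    obtain ⟨T, hT, hTq, -⟩ := hq z (hrq (hdr₀ hz.1)) ((hxt'.trans hts).trans hsz)
    -- Thus `d₀` has trunk `z`, lies below `T` and belongs to `D k`, so by `Meets` the tree `T` is
    -- already below a member of `D k` in the submodel, and `d₀` witnesses its compatibility with
    -- `r`.
    have hdT : d₀ ≤ T := fun u hu => hTq ⟨hrq (hdr₀ hu), hz.2.1 u hu⟩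
    obtain ⟨d', hd', hd'N, hTd'⟩ := hT.2.2 k (Nat.lt_of_lt_of_le hlen hsz.length_le)
      ⟨d₀, hdT, hz, _, hd, fun _ h => h⟩
    exact ⟨d', hd', hd'N, treeCode d₀, hEd.1 hd, idealForcing_le.2
      ⟨hEd.1 hd, hEd.1 hd', fun u hu => hTd' (treeCode_subset.2 hdT hu)⟩,
      idealForcing_le.2 ⟨hEd.1 hd, hr, treeCode_subset.2 hdr₀⟩⟩
  · obtain ⟨r, ⟨t, hrt⟩, rfl⟩ := mem_condSet.1 hr
    have hrq := treeCode_subset.1 (idealForcing_le.1 hrq).2.2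
    obtain ⟨t', ht', hxt'⟩ := hrt.exists_extension fun s hs => hqt.2.1 s (hrq hs)
    rcases ht'.exists_small_or_branch with ⟨z, hz, htz, hsmall⟩ | ⟨U, hUr, hUc, hU⟩
    · obtain ⟨T, hT, hTq, hTn⟩ := hq z (hrq hz) (hxt'.trans htz)
      have hRt := trunk_restrict ht' hz htz
      have hRT : restrict r z ≤ T := (restrict_mono hrq z).trans hTq
      obtain ⟨F, hFN, hFU, hF⟩ := hU T z hT (positive_mono
        (fun n hn => ⟨hRT hn, hsmall n hn.1⟩) (hRt.2.2 z hRt.1 List.prefix_rfl))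
      refine ⟨F, hFN, hFU.1, fun b hb hbN hrb => ?_⟩
      by_contra hbF
      obtain ⟨b', hb'N, hb'F, hdisj⟩ := h.exists_disjoint_mem hFU hFN hbN hb hbF
      obtain ⟨n, hn, hnb'⟩ := hF b' hb'F hb'N _ hRT hRt
        fun n hn => ⟨(hTn n (hrq hn.1)).1, hsmall n hn.1⟩
      have hGt := trunk_restrict ht' hn.1 (htz.trans (List.prefix_append _ _))
      have hGnx : restrict r (z ++ [n]) ≤ nx T z n :=
        (restrict_mono hrq _).trans (hTn n (hrq hn.1)).2
      -- The part of `r` through `z ++ [n]` lies in `b` because it is below `r`, and in `b'` because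
      -- it is below `nx T z n`.
      exact hdisj _ (RO_down hb (hrb (SetPoset.mem_embed_self hr)) (restrict_le _ _) ⟨_, hGt⟩)
        (RO_down (hFU.1.1 hb'F) hnb' hGnx ⟨_, hGt⟩)
    · refine absurd ⟨treeCode U, treeCode_mem_condSet.2 hUc,
        treeCode_subset.2 (hUr.trans (hrq.trans (hqS'.trans hS'S))), fun V hV hVU => ?_⟩ hmin
      obtain ⟨V, hVc, rfl⟩ := mem_condSet.1 hV
      have hVU := treeCode_subset.1 hVU
      rw [le_antisymm hVU (le_of_comparable hU hVc hVU)]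

theorem exists_isYMaster (h : IsModelOf N I) (hI : IsIntersectionOfFSigmaIdeals I)
    (hN : (setsOf N).Countable) {p : ZFSet.{u}} (hp : p ∈ condSet I) (hpN : p ∈ setsOf N) :
    ∃ q ∈ condSet I, (idealForcing.{u} I).Le q p ∧
      (idealForcing.{u} I).IsYMaster (setsOf N) q := by
  by_cases hmin : ∃ U ∈ condSet.{u} I, U ⊆ p ∧ ∀ V ∈ condSet I, V ⊆ U → V = U
  · have hC := Tm.par h.condSet_mem
    obtain ⟨U, hUC, hU⟩ := hmin
    obtain ⟨U, hUN, hUC, hUp, hU⟩ := exists_mem_of_dfn (N := N)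
      (φ := fun U => U ∈ condSet I ∧ U ⊆ p ∧ ∀ V ∈ condSet I, V ⊆ U → V = U)
      (Dfn.and (Dfn.mem (Tm.var 0) hC) (Dfn.and (Dfn.subset (Tm.var 0) (Tm.par hpN))
        (Dfn.ball hC (Dfn.imp (Dfn.subset (Tm.var 0) (Tm.var 1))
          (Dfn.eq (Tm.var 0) (Tm.var 1))))))
      ⟨U, h.mem_H_of_mem_condSet hUC, hUC, hU⟩
    exact ⟨U, hUC, idealForcing_le.2 ⟨hUC, hp, hUp⟩, h.isYMaster_of_minimal hUN hUC hU⟩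
  · obtain ⟨S, ⟨x, ht⟩, rfl⟩ := mem_condSet.1 hp
    obtain ⟨q, hqS, hqc, hq⟩ := h.exists_isYMaster_of_no_minimal hI hN hpN ht hmin
    have hqC := treeCode_mem_condSet.2 hqc
    exact ⟨treeCode q, hqC, idealForcing_le.2 ⟨hqC, hp, treeCode_subset.2 hqS⟩, hq⟩

end IsModelOf

/-- The transitive closure of `x` consists of sets of rank below `o`, so it is contained in a level
of the von Neumann hierarchy of size less than `θ`. -/
theorem mem_H_of_rank_lt {θ : Cardinal.{u}} {o : Ordinal.{u}}
    (hθ : (ZFSet.vonNeumann o).card < θ) {x : ZFSet.{u}} (hx : x.rank < o) : x ∈ H θ := by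
  have hrank : ∀ z, Relation.TransGen (fun a b : ZFSet.{u} => a ∈ b) z x → z.rank < x.rank := by
    intro z hz
    induction hz using Relation.TransGen.head_induction_on with
    | single h => exact ZFSet.rank_lt_of_mem h
    | head h _ ih => exact (ZFSet.rank_lt_of_mem h).trans ih
  refine lt_of_le_of_lt (b := Cardinal.mk (ZFSet.vonNeumann o)) (Cardinal.mk_le_of_injective
    (f := fun z => ⟨z.1, ZFSet.mem_vonNeumann.2 ((hrank z.1 z.2).trans hx)⟩) ?_) ?_
  · intro a b h
    simpa [Subtype.ext_iff] using h
  · rw [ZFSet.cardinalMk_coe_sort]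
    exact Cardinal.lift_lt.2 hθ

theorem yProper_idealForcing (hI : IsIntersectionOfFSigmaIdeals I) :
    (idealForcing.{u} I).YProper := by
  refine ⟨Order.succ (ZFSet.vonNeumann ((condSet.{u} I).rank + Ordinal.omega0)).card,
    fun θ hθ _ M hM hP p hp hpM => ?_⟩
  obtain ⟨hcount, N, rfl⟩ := hM
  have h : IsModelOf N I := ⟨fun x hx => mem_H_of_rank_lt (Order.succ_le_iff.1 hθ) hx, hP⟩
  exact h.exists_isYMaster hI hcount hp hpM

/-- The ideal of finite sets of natural numbers. -/
def finiteIdeal : Order.Ideal (Set ℕ) where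
  carrier := {a | a.Finite}
  lower' _ _ h ha := Set.Finite.subset ha h
  nonempty' := ⟨∅, Set.finite_empty⟩
  directed' a ha b hb := ⟨a ∪ b, Set.Finite.union ha hb, Set.subset_union_left,
    Set.subset_union_right⟩

theorem mem_finiteIdeal {a : Set ℕ} : a ∈ finiteIdeal ↔ a.Finite := Iff.rfl

theorem isFSigmaIdeal_finiteIdeal : IsFSigmaIdeal finiteIdeal := by
  -- The `k`-th closed set consists of the characteristic functions of subsets of `{0, ..., k - 1}`.
  refine ⟨fun k => ⋂ n ≥ k, {x : ℕ → Bool | x n = false}, fun k => ?_, ?_⟩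
  · exact isClosed_biInter fun n _ => (isClopen_discrete {false}).isClosed.preimage
      (f := fun x : ℕ → Bool => x n) (continuous_apply n)
  · ext x
    simp only [Set.mem_ofPred_eq, mem_finiteIdeal, Set.mem_iUnion, Set.mem_iInter]
    constructor
    · intro hx
      obtain ⟨k, hk⟩ := hx.bddAbove
      refine ⟨k + 1, fun n hn => Bool.eq_false_of_not_eq_true fun h => ?_⟩
      exact absurd (hk h) (by omega)
    · rintro ⟨k, hk⟩
      refine (Set.finite_lt_nat k).subset fun n hn => ?_
      by_contra hnk
      have := hk n (not_lt.1 hnk)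
      exact Bool.false_ne_true (this.symm.trans hn)

theorem laverForcing_eq : laverForcing.{u} = idealForcing finiteIdeal := rfl

theorem yProper_laverForcing : laverForcing.{u}.YProper := by
  rw [laverForcing_eq]
  exact yProper_idealForcing ⟨{finiteIdeal}, by
    rintro J rfl
    exact isFSigmaIdeal_finiteIdeal, fun a => by simp⟩

end YProperness

theorem mainTheorem11 :
    (∀ I : Order.Ideal (Set ℕ), YProperness.IsIntersectionOfFSigmaIdeals I →
      (YProperness.idealForcing.{u} I).YProper) ∧
    YProperness.laverForcing.{u}.YProper :=
  ⟨fun _ hI => YProperness.yProper_idealForcing hI, YProperness.yProper_laverForcing⟩
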